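/- Let $\mathbb{H}^2$ be the hyperbolic plane in the Poincaré disc model, i.e. the unit disc $\{z\in\mathbb{C}:|z|<1\}$ with the metric $$d_h(x,y)=\cosh^{-1}\Big(1+\frac{2|x-y|^2}{(1-|x|^2)(1-|y|^2)}\Big),$$ and let $v^h$ be its area measure, $dv^h=\sinh(\rho)\,d\rho\,d\theta$ in hyperbolic polar coordinates $(\rho,\theta)\in[0,\infty)\times[0,2\pi)$ about the origin $o$. For $L>0$, $x\in\mathbb{H}^2$ and $\phi\in[0,\pi)$ let $l_L(x,\phi)$ (a stick) be the closed geodesic segment of length $L$ with centre $x$ whose angle, measured counterclockwise, to the geodesic through $o$ and $x$ (to the horizontal axis if $x=o$) is $\phi$. For $\lambda>0$ let $\omega^{\lambda,L}$ be a Poisson point process on $\mathbb{H}^2\times[0,\pi)$ with intensity measure $\lambda\, v^h\otimes\Phi$, where $\Phi$ is the uniform probability measure on $[0,\pi)$, let $$\mathcal{C}(\omega^{\lambda,L})=\bigcup_{(x,\phi)\in\omega^{\lambda,L}} l_L(x,\phi),$$ and let $$\lambda_c(L)=\inf\{\lambda>0:\ \mathbb{P}(\mathcal{C}(\omega^{\lambda,L})\text{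 contains an unbounded connected component})>0\}\in[0,\infty]$$ (with $\inf\emptyset=\infty$). Then for every $L\ge 10$, $$\lambda_c(L)\ \ge\ \frac{\pi}{2}\,L^{-2}.$$ -/

import Mathlib

open MeasureTheory ProbabilityTheory
open scoped NNReal ENNReal ComplexConjugate

noncomputable section

namespace PoissonStick

/-! ### Poisson point processes -/

section Poisson

variable {X : Type*} [MeasurableSpace X] [Nonempty X]

/-- The probability measure `ν / ν(X)` for a finite measure `ν ≠ 0`
(an arbitrary Dirac mass if `ν = 0`). -/
def normalized (ν : Measure X) [IsFiniteMeasure ν] : Measure X :=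
  (FiniteMeasure.normalize ⟨ν, inferInstance⟩ : ProbabilityMeasure X)

instance (ν : Measure X) [IsFiniteMeasure ν] : IsProbabilityMeasure (normalized ν) := by
  unfold normalized; infer_instance

/-- The sample space on which a Poisson point process on `X` is built: a sample consists of
numbers `N n` of points and of points `x n i`, for `n i : ℕ`. -/
abbrev Sample (X : Type*) : Type _ := (ℕ → ℕ) × (ℕ → ℕ → X)

/-- The random set of points of the Poisson process: `{x n i | n, i : ℕ, i < N n}`. -/
def points (s : Sample X) : Set X := {p | ∃ n i, i < s.1 n ∧ p = s.2 n i}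

/-- The probability measure on `Sample X` under which `points` is a Poisson point process with
s-finite intensity measure `Λ`. Write `Λ = ∑ Λₙ` with finite measures `Λₙ`. All the variables
`N n` and `x n i` are independent, `N n` has the Poisson distribution with mean `Λₙ(X)`, and
every `x n i` has the law `Λₙ / Λₙ(X)`. (This is the standard construction; the law of the
process does not depend on the decomposition of `Λ`. In the stick model `Λ` has no atoms, so
that almost surely no point is repeated and the process is determined by its set of points.) -/
def poissonProcessMeasure (Λ : Measure X) [SFinite Λ] : Measure (Sample X) :=
  (Measure.infinitePi fun n : ℕ => poissonMeasure (sfiniteSeq Λ n Set.univ).toNNReal).prod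
    (Measure.infinitePi fun n : ℕ => Measure.infinitePi fun _ : ℕ => normalized (sfiniteSeq Λ n))

end Poisson

/-! ### The hyperbolic plane (Poincaré disc model) -/

/-- The hyperbolic plane, as the unit disc of `ℂ` with its usual topology (which is also the
topology of the hyperbolic metric `hypDist`). -/
abbrev H2 : Type := Complex.UnitDisc

instance : MeasurableSpace H2 := borel H2

instance : BorelSpace H2 := ⟨rfl⟩

/-- The hyperbolic distance. -/
def hypDist (x y : H2) : ℝ :=
  Real.arcosh (1 + 2 * ‖(x : ℂ) - y‖ ^ 2 / ((1 - ‖(x : ℂ)‖ ^ 2) * (1 - ‖(y : ℂ)‖ ^ 2)))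

lemma norm_polar_lt_one (r t : ℝ) :
    ‖(Real.tanh (r / 2) : ℂ) * Complex.exp (t * Complex.I)‖ < 1 := by
  rw [norm_mul, Complex.norm_exp_ofReal_mul_I, mul_one, Complex.norm_real, Real.norm_eq_abs]
  exact Real.abs_tanh_lt_one _

/-- The point with hyperbolic polar coordinates `(r, t)`: it lies at hyperbolic distance `r`
from the origin, and `t` is its angle from the positive horizontal axis. -/
def polar (r t : ℝ) : H2 :=
  Complex.UnitDisc.mk ((Real.tanh (r / 2) : ℂ) * Complex.exp (t * Complex.I))
    (norm_polar_lt_one r t)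

lemma measurable_polar : Measurable fun p : ℝ × ℝ => polar p.1 p.2 := by
  apply Continuous.measurable
  rw [Complex.UnitDisc.isEmbedding_coe.continuous_iff]
  have h : Continuous Real.tanh := by
    have : Real.tanh = fun x => Real.sinh x / Real.cosh x := by
      funext x; exact Real.tanh_eq_sinh_div_cosh x
    rw [this]
    exact Real.continuous_sinh.div Real.continuous_cosh fun x => (Real.cosh_pos x).ne'
  change Continuous fun p : ℝ × ℝ =>
    (Real.tanh (p.1 / 2) : ℂ) * Complex.exp (p.2 * Complex.I)
  have h2 : Continuous fun p : ℝ × ℝ => Real.tanh (p.1 / 2) := h.comp (by fun_prop)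
  exact (Complex.continuous_ofReal.comp h2).mul (by fun_prop)

/-- The hyperbolic area measure: `sinh r dr dt` in hyperbolic polar coordinates
`(r, t) ∈ [0, ∞) × [0, 2π)`. -/
def hypArea : Measure H2 :=
  (((volume.restrict (Set.Ici (0 : ℝ))).prod
      (volume.restrict (Set.Ico (0 : ℝ) (2 * Real.pi)))).withDensity
    fun p => ENNReal.ofReal (Real.sinh p.1)).map fun p : ℝ × ℝ => polar p.1 p.2

instance : SFinite hypArea := by unfold hypArea; infer_instance

lemma norm_translation_lt_one (x z : H2) :
    ‖((z : ℂ) + x) / (1 + conj (x : ℂ) * z)‖ < 1 := by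
  have hx := x.normSq_lt_one
  have hz := z.normSq_lt_one
  have key : Complex.normSq ((z : ℂ) + x) < Complex.normSq (1 + conj (x : ℂ) * z) := by
    simp only [Complex.normSq_apply, Complex.add_re, Complex.add_im, Complex.mul_re,
      Complex.mul_im, Complex.conj_re, Complex.conj_im, Complex.one_re, Complex.one_im] at *
    nlinarith [mul_pos (sub_pos.2 hx) (sub_pos.2 hz)]
  rw [Complex.normSq_eq_norm_sq, Complex.normSq_eq_norm_sq] at key
  have h := lt_of_pow_lt_pow_left₀ 2 (norm_nonneg _) key
  rw [norm_div, div_lt_one ((norm_nonneg _).trans_lt h)]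
  exact h

/-- The translation `z ↦ (z + x) / (1 + x̄ z)`: the orientation preserving isometry that maps the
origin to `x`, and that leaves the geodesic through the origin and `x` invariant and fixes the
two endpoints at infinity of this geodesic (for `x` the origin, it is the identity). -/
def translation (x z : H2) : H2 :=
  Complex.UnitDisc.mk (((z : ℂ) + x) / (1 + conj (x : ℂ) * z)) (norm_translation_lt_one x z)

/-! ### The stick model -/

/-- The stick of length `L` centred at the origin, at angle `φ` to the horizontal axis. -/
def originStick (L φ : ℝ) : Set H2 :=
  (fun r => polar r φ) '' Set.Icc 0 (L / 2) ∪ (fun r => polar r (φ + Real.pi)) '' Set.Icc 0 (L / 2)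

/-- `originStick L` has period `π`; so it does not matter that angles are not reduced modulo `π`
in the definition of `stick`. -/
lemma originStick_add_pi (L φ : ℝ) : originStick L (φ + Real.pi) = originStick L φ := by
  have h : ∀ r, polar r (φ + Real.pi + Real.pi) = polar r φ := by
    intro r
    apply Complex.UnitDisc.coe_injective
    change (_ : ℂ) * Complex.exp (((φ + Real.pi + Real.pi : ℝ) : ℂ) * Complex.I)
      = _ * Complex.exp ((φ : ℂ) * Complex.I)
    congr 1
    rw [← Complex.exp_periodic ((φ : ℂ) * Complex.I)]
    congr 1
    push_cast
    ring
  simp only [originStick, h]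
  exact Set.union_comm _ _

/-- The stick of length `L` with centre `x`, at angle `φ`, measured counterclockwise, to the
geodesic through the origin and `x` (to the horizontal axis if `x` is the origin). -/
def stick (L : ℝ) (x : H2) (φ : ℝ) : Set H2 :=
  translation x '' originStick L (φ + Complex.arg (x : ℂ))

/-- The uniform probability measure on the set `[0, π)` of angles. -/
def angleMeasure : Measure ℝ :=
  (ENNReal.ofReal Real.pi)⁻¹ • volume.restrict (Set.Ico 0 Real.pi)

instance : SFinite angleMeasure := by unfold angleMeasure; infer_instance

/-- The intensity measure (at intensity `1`) on pairs (centre, angle). -/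
def stickMeasure : Measure (H2 × ℝ) := hypArea.prod angleMeasure

instance : SFinite stickMeasure := by unfold stickMeasure; infer_instance

/-- The law of the Poisson process of (centre, angle) pairs with intensity measure
`l • stickMeasure`. -/
def stickLaw (l : ℝ≥0) : Measure (Sample (H2 × ℝ)) := poissonProcessMeasure (l • stickMeasure)

/-- The occupied set: the union of the sticks of length `L` of the process. -/
def occupied (L : ℝ) (s : Sample (H2 × ℝ)) : Set H2 := ⋃ p ∈ points s, stick L p.1 p.2

/-- A set is unbounded if it is contained in no hyperbolic ball about the origin. -/
def HypUnbounded (A : Set H2) : Prop := ∀ R : ℝ, ∃ y ∈ A, R < hypDist 0 y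

/-- `C` contains an unbounded connected component. -/
def HasUnboundedComponent (C : Set H2) : Prop := ∃ x ∈ C, HypUnbounded (connectedComponentIn C x)

/-- The critical intensity `λ_c(L)`: the infimum, in `[0, ∞]`, of the intensities `l > 0` for
which with positive probability the occupied set contains an unbounded connected component. -/
def criticalIntensity (L : ℝ) : ℝ≥0∞ :=
  sInf {t | ∃ l : ℝ≥0, 0 < l ∧ 0 < stickLaw l {s | HasUnboundedComponent (occupied L s)} ∧ t = l}

end PoissonStick

end

/-!
The sticks of the process that can be reached from a given stick are explored as in a branching
process: the mean number of sticks that hit a given stick is `m = l * (2 * L ^ 2 / π)`, which is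
less than `1` for `l < π / 2 * L⁻²`. Hence there are no arbitrarily long self-avoiding chains of
intersecting sticks, and clusters are bounded.

*The mean number of hits* (`stickMeasure_hits_le`). By the kinematic formula, the stick measure of
the sticks that hit a given stick of length `L` is `2 * L ^ 2 / π`; only the upper bound is needed.
For a fixed centre `x`, the hitting directions are those in which the part of the given stick at
distance at most `L / 2` is seen from `x`. Their total length is at most the integral along this
part of the rate at which the direction turns (`volume_directions_le`). By Tonelli's theorem one can
first integrate over `x`, for a fixed point `z` of the given stick. The hyperbolic area is invariant
under the translation that maps the origin to `z` (`map_translation_hypArea`), so that `z` may be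
taken to be the origin, where in polar coordinates the rate is `|sin (α - t)| / sinh r` and the area
is `sinh r dr dt`; the integral is `4 * (L / 2)` for every `z` (`lintegral_nearTurningRate_le`), and
the integral over the given stick is `2 * L ^ 2`.

*Chains* (`measure_chainFrom_le`). By the reduced Mecke formula (`lintegral_tsum_removePoint`), the
mean number of self-avoiding chains of `k` sticks that start next to a given stick is at most
`m ^ k`: removing the first stick of the chain leaves a process with the same law. The sticks with
centres in a ball have a finite mean number, so that almost surely the chains that start in the ball
have a bounded length (`ae_exists_notMem_chainFrom`).

*Topology* (`not_hasUnboundedComponent`). Almost surely, the sticks are locally finite. So the union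
of the sticks of a cluster and the union of all other sticks are disjoint closed sets, and a
connected component of the occupied set lies in a single cluster. A cluster is bounded, since
between two of its sticks there is a self-avoiding path of bounded length.
-/

namespace PoissonStick

/-! ### Product measures and resampling of one coordinate -/

lemma lintegral_map_prod {α β γ : Type*} [MeasurableSpace α] [MeasurableSpace β]
    [MeasurableSpace γ] {μ : Measure α} {ν : Measure β} [SFinite ν] {f : α × β → γ}
    (hf : Measurable f) {g : γ → ℝ≥0∞} (hg : Measurable g) :
    ∫⁻ c, g c ∂((μ.prod ν).map f) = ∫⁻ a, ∫⁻ b, g (f (a, b)) ∂ν ∂μ := by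
  rw [lintegral_map hg hf]
  exact lintegral_prod _ (hg.comp hf).aemeasurable

lemma lintegral_map_prod_symm {α β γ : Type*} [MeasurableSpace α] [MeasurableSpace β]
    [MeasurableSpace γ] {μ : Measure α} {ν : Measure β} [SFinite μ] [SFinite ν] {f : α × β → γ}
    (hf : Measurable f) {g : γ → ℝ≥0∞} (hg : Measurable g) :
    ∫⁻ c, g c ∂((μ.prod ν).map f) = ∫⁻ b, ∫⁻ a, g (f (a, b)) ∂μ ∂ν := by
  rw [lintegral_map hg hf]
  exact lintegral_prod_symm _ (hg.comp hf).aemeasurable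

lemma measurable_update_apply {ι : Type*} [DecidableEq ι] {Y : ι → Type*}
    [∀ i, MeasurableSpace (Y i)] {Z : Type*} [MeasurableSpace Z] (n : ι) {f : Z → ∀ i, Y i}
    (hf : Measurable f) {g : Z → Y n} (hg : Measurable g) :
    Measurable fun z => Function.update (f z) n (g z) := by
  refine measurable_pi_lambda _ fun i => ?_
  by_cases h : i = n
  · subst h
    simpa using hg
  · simp only [Function.update_of_ne h]
    exact (measurable_pi_apply i).comp hf

/-- Resampling one coordinate of a product measure does not change its law. -/
lemma map_update_infinitePi {ι : Type*} [DecidableEq ι] {Y : ι → Type*}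
    [∀ i, MeasurableSpace (Y i)] (μ : ∀ i, Measure (Y i)) [∀ i, IsProbabilityMeasure (μ i)]
    (n : ι) :
    ((μ n).prod (Measure.infinitePi μ)).map (fun p => Function.update p.2 n p.1)
      = Measure.infinitePi μ := by
  have hm : Measurable (fun p : Y n × (∀ i, Y i) => Function.update p.2 n p.1) :=
    measurable_update_apply n measurable_snd measurable_fst
  refine Measure.eq_infinitePi _ fun s t ht => ?_
  rw [Measure.map_apply hm (.pi s.countable_toSet fun i _ => ht i)]
  by_cases hn : n ∈ s
  · have : (fun p : Y n × (∀ i, Y i) => Function.update p.2 n p.1) ⁻¹' (Set.pi s t)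
        = t n ×ˢ Set.pi (s.erase n : Finset ι) t := by
      ext p
      simp only [Set.mem_preimage, Set.mem_pi, Set.mem_prod, Finset.mem_coe, Finset.mem_erase]
      constructor
      · intro h
        refine ⟨by simpa using h n hn, fun i hi => ?_⟩
        simpa [Function.update_of_ne hi.1] using h i hi.2
      · rintro ⟨h1, h2⟩ i hi
        by_cases h : i = n
        · subst h
          simpa using h1
        · simpa [Function.update_of_ne h] using h2 i ⟨h, hi⟩
    rw [this, Measure.prod_prod, Measure.infinitePi_pi _ (fun i _ => ht i),
      Finset.mul_prod_erase s (fun i => μ i (t i)) hn]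
  · have : (fun p : Y n × (∀ i, Y i) => Function.update p.2 n p.1) ⁻¹' (Set.pi s t)
        = Set.univ ×ˢ Set.pi s t := by
      ext p
      simp only [Set.mem_preimage, Set.mem_pi, Set.mem_prod, Finset.mem_coe, Set.mem_univ,
        true_and]
      refine forall₂_congr fun i hi => ?_
      rw [Function.update_of_ne (fun h => by subst h; exact hn hi)]
    rw [this, Measure.prod_prod, Measure.infinitePi_pi _ (fun i _ => ht i), measure_univ, one_mul]

/-- The increasing enumeration of the natural numbers other than `i`. -/
def skip (i j : ℕ) : ℕ := if j < i then j else j + 1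

/-- The left inverse of `skip i`. -/
def unskip (i j : ℕ) : ℕ := if j < i then j else j - 1

lemma skip_ne (i j : ℕ) : skip i j ≠ i := by unfold skip; grind

lemma unskip_skip (i j : ℕ) : unskip i (skip i j) = j := by unfold skip unskip; grind

lemma skip_unskip {i j : ℕ} (h : j ≠ i) : skip i (unskip i j) = j := by
  unfold skip unskip; grind

lemma skip_injective (i : ℕ) : Function.Injective (skip i) :=
  Function.LeftInverse.injective (unskip_skip i)

/-- Inserting an independent point with the law `ν` into an i.i.d. sequence with the law `ν`
gives again such a sequence. -/
lemma map_insert_infinitePi {X : Type*} [MeasurableSpace X] (ν : Measure X)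
    [IsProbabilityMeasure ν] (i : ℕ) :
    (ν.prod (Measure.infinitePi fun _ : ℕ => ν)).map
        (fun p j => if j = i then p.1 else p.2 (unskip i j))
      = Measure.infinitePi fun _ : ℕ => ν := by
  have hm : Measurable (fun (p : X × (ℕ → X)) (j : ℕ) =>
      if j = i then p.1 else p.2 (unskip i j)) := by
    refine measurable_pi_lambda _ fun j => ?_
    by_cases h : j = i
    · simpa [h] using measurable_fst
    · simp only [h, if_false]
      exact (measurable_pi_apply (unskip i j)).comp measurable_snd
  refine Measure.eq_infinitePi _ fun s t ht => ?_
  rw [Measure.map_apply hm (.pi s.countable_toSet fun j _ => ht j)]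
  set s' := s.preimage (skip i) (skip_injective i).injOn
  have key : (fun (p : X × (ℕ → X)) (j : ℕ) =>
      if j = i then p.1 else p.2 (unskip i j)) ⁻¹' (Set.pi s t)
        = (if i ∈ s then t i else Set.univ) ×ˢ Set.pi s' (fun j => t (skip i j)) := by
    ext p
    simp only [Set.mem_preimage, Set.mem_pi, Set.mem_prod, Finset.mem_coe, s',
      Finset.mem_preimage]
    constructor
    · intro h
      refine ⟨?_, fun j hj => ?_⟩
      · split_ifs with hi
        · simpa using h i hi
        · trivial
      · simpa [skip_ne, unskip_skip] using h _ hj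
    · rintro ⟨h1, h2⟩ j hj
      by_cases h : j = i
      · subst h
        simpa [hj] using h1
      · have := h2 (unskip i j) (by rwa [skip_unskip h])
        rw [skip_unskip h] at this
        simpa [h] using this
  rw [key, Measure.prod_prod, Measure.infinitePi_pi _ (fun j _ => ht _)]
  have h2 : ∏ j ∈ s', ν (t (skip i j)) = ∏ j ∈ s.erase i, ν (t j) := by
    have : s' = (s.erase i).preimage (skip i) (skip_injective i).injOn := by
      ext j; simp [s', skip_ne]
    rw [this]
    refine Finset.prod_preimage (skip i) (s.erase i) _ (fun j => ν (t j)) fun j hj hj' => ?_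
    exact absurd ⟨unskip i j, skip_unskip (Finset.ne_of_mem_erase hj)⟩ hj'
  rw [h2]
  split_ifs with hi
  · exact Finset.mul_prod_erase s (fun i => ν (t i)) hi
  · rw [Finset.erase_eq_of_notMem hi, measure_univ, one_mul]

/-! ### The reduced Mecke inequality -/

lemma smul_normalized {X : Type*} [MeasurableSpace X] [Nonempty X] (ν : Measure X)
    [IsFiniteMeasure ν] : ((ν Set.univ).toNNReal : ℝ≥0∞) • normalized ν = ν := by
  ext s hs
  set μ : FiniteMeasure X := ⟨ν, inferInstance⟩
  have h := congrArg (fun r : ℝ≥0 => (r : ℝ≥0∞)) (FiniteMeasure.self_eq_mass_mul_normalize μ s)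
  simp only [ENNReal.coe_mul, ProbabilityMeasure.ennreal_coeFn_eq_coeFn_toMeasure] at h
  rw [FiniteMeasure.ennreal_coeFn_eq_coeFn_toMeasure μ s] at h
  exact h.symm

lemma lintegral_poissonMeasure (r : ℝ≥0) (f : ℕ → ℝ≥0∞) :
    ∫⁻ n, f n ∂(poissonMeasure r)
      = ∑' n, ENNReal.ofReal (Real.exp (-r) * r ^ n / n.factorial) * f n := by
  rw [poissonMeasure, lintegral_sum_measure]
  refine tsum_congr fun n => ?_
  rw [lintegral_smul_measure, lintegral_dirac, smul_eq_mul]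

/-- The one-dimensional Mecke equation `E[N g(N - 1)] = r E[g(N)]` for a Poisson variable. -/
lemma lintegral_natCast_mul_poissonMeasure (r : ℝ≥0) (g : ℕ → ℝ≥0∞) :
    ∫⁻ n, n * g (n - 1) ∂(poissonMeasure r) = r * ∫⁻ n, g n ∂(poissonMeasure r) := by
  rw [lintegral_poissonMeasure, lintegral_poissonMeasure, tsum_eq_zero_add' ENNReal.summable,
    ← ENNReal.tsum_mul_left]
  simp only [Nat.cast_zero, zero_mul, mul_zero, zero_add, Nat.add_sub_cancel]
  refine tsum_congr fun n => ?_
  rw [← mul_assoc, ← mul_assoc]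
  congr 1
  rw [← ENNReal.ofReal_natCast (n + 1), ← ENNReal.ofReal_coe_nnreal,
    ← ENNReal.ofReal_mul (by positivity), ← ENNReal.ofReal_mul (by positivity)]
  congr 1
  rw [Nat.factorial_succ]
  push_cast
  field_simp
  ring

section Mecke

variable {X : Type*} [MeasurableSpace X]

/-- The sample from which the point `x n i` has been removed, the later points of the `n`-th
sequence moving up. -/
def removePoint (n i : ℕ) (s : Sample X) : Sample X :=
  (Function.update s.1 n (s.1 n - 1), Function.update s.2 n fun j => s.2 n (skip i j))

lemma measurable_removePoint (n i : ℕ) : Measurable (removePoint (X := X) n i) := by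
  refine (measurable_update_apply n measurable_fst ?_).prodMk
    (measurable_update_apply n measurable_snd ?_)
  · exact (measurable_of_countable fun k : ℕ => k - 1).comp
      ((measurable_pi_apply n).comp measurable_fst)
  · refine measurable_pi_lambda _ fun j => ?_
    exact (measurable_pi_apply _).comp ((measurable_pi_apply n).comp measurable_snd)

/-- In an array of independent points whose rows are i.i.d., a single point is independent of the
array obtained by removing it, and the latter has the law of the original array. -/
lemma lintegral_removeRow (ν : ℕ → Measure X) [∀ n, IsProbabilityMeasure (ν n)] (n i : ℕ)
    (Φ : X × (ℕ → ℕ → X) → ℝ≥0∞) (hΦ : Measurable Φ) :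
    ∫⁻ x, Φ (x n i, Function.update x n fun j => x n (skip i j))
        ∂(Measure.infinitePi fun n => Measure.infinitePi fun _ : ℕ => ν n)
      = ∫⁻ p, ∫⁻ x, Φ (p, x) ∂(Measure.infinitePi fun n => Measure.infinitePi fun _ : ℕ => ν n)
          ∂(ν n) := by
  set R : ℕ → Measure (ℕ → X) := fun n => Measure.infinitePi fun _ : ℕ => ν n with hR
  set Q := Measure.infinitePi R with hQ
  have hup : Measurable fun p : (ℕ → X) × (ℕ → ℕ → X) => Function.update p.2 n p.1 :=
    measurable_update_apply n measurable_snd measurable_fst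
  have hsk : Measurable fun y : ℕ → X => fun j => y (skip i j) :=
    measurable_pi_lambda _ fun j => measurable_pi_apply _
  have hins : Measurable (fun (p : X × (ℕ → X)) (j : ℕ) =>
      if j = i then p.1 else p.2 (unskip i j)) := by
    refine measurable_pi_lambda _ fun j => ?_
    by_cases h : j = i
    · simpa [h] using measurable_fst
    · simp only [h, if_false]
      exact (measurable_pi_apply (unskip i j)).comp measurable_snd
  have h1 : Measurable fun q : (ℕ → X) × (ℕ → ℕ → X) =>
      Φ (q.1 i, Function.update q.2 n fun j => q.1 (skip i j)) :=
    hΦ.comp (((measurable_pi_apply i).comp measurable_fst).prodMk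
      (measurable_update_apply n measurable_snd (hsk.comp measurable_fst)))
  have h2 : Measurable fun x : ℕ → ℕ → X =>
      Φ (x n i, Function.update x n fun j => x n (skip i j)) :=
    hΦ.comp (((measurable_pi_apply i).comp (measurable_pi_apply n)).prodMk
      (measurable_update_apply n measurable_id (hsk.comp (measurable_pi_apply n))))
  calc _ = ∫⁻ y, ∫⁻ x, Φ (y i, Function.update x n fun j => y (skip i j)) ∂Q ∂(R n) := by
        conv_lhs => rw [hQ, ← map_update_infinitePi R n]
        rw [lintegral_map_prod hup h2]
        simp only [Function.update_self, Function.update_idem, Q]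
    _ = ∫⁻ p, ∫⁻ y, ∫⁻ x, Φ (p, Function.update x n y) ∂Q ∂(R n) ∂(ν n) := by
        conv_lhs => rw [hR]; simp only []; rw [← map_insert_infinitePi (ν n) i]
        rw [lintegral_map_prod hins h1.lintegral_prod_right']
        simp only [skip_ne, unskip_skip, if_true, if_false, R]
    _ = _ := by
        refine lintegral_congr fun p => ?_
        have h3 : Measurable fun x : ℕ → ℕ → X => Φ (p, x) := hΦ.comp measurable_prodMk_left
        conv_rhs => rw [hQ, ← map_update_infinitePi R n]
        rw [lintegral_map_prod hup h3]

lemma measurable_removePoint_summand {F : X × Sample X → ℝ≥0∞} (hF : Measurable F) (n i : ℕ) :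
    Measurable fun s : Sample X =>
      (if i < s.1 n then F (s.2 n i, removePoint n i s) else 0) := by
  refine Measurable.ite ?_ ?_ measurable_const
  · exact ((measurable_pi_apply n).comp measurable_fst) (measurableSet_Ioi (a := i))
  · exact hF.comp (((measurable_pi_apply i).comp
      ((measurable_pi_apply n).comp measurable_snd)).prodMk (measurable_removePoint n i))

variable [Nonempty X]

/-- The reduced Mecke formula: adding up, over the points of a Poisson process, a function of the
point and of the rest of the process amounts, in the mean, to integrating over an additional
independent point. -/
theorem lintegral_tsum_removePoint (Λ : Measure X) [SFinite Λ] (F : X × Sample X → ℝ≥0∞)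
    (hF : Measurable F) :
    ∫⁻ s, ∑' n, ∑' i, (if i < s.1 n then F (s.2 n i, removePoint n i s) else 0)
        ∂(poissonProcessMeasure Λ)
      = ∫⁻ p, ∫⁻ s, F (p, s) ∂(poissonProcessMeasure Λ) ∂Λ := by
  set ν : ℕ → Measure X := fun n => normalized (sfiniteSeq Λ n) with hν
  set ρ : ℕ → ℝ≥0 := fun n => (sfiniteSeq Λ n Set.univ).toNNReal with hρ
  set Q : Measure (ℕ → ℕ → X) :=
    Measure.infinitePi fun n => Measure.infinitePi fun _ : ℕ => ν n with hQ
  set A : Measure (ℕ → ℕ) := Measure.infinitePi fun n => poissonMeasure (ρ n) with hA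
  have hP : poissonProcessMeasure Λ = A.prod Q := rfl
  have hmeas := measurable_removePoint_summand hF
  -- `G n N` is the mean of `F` if the numbers of points are `N` and the added point is drawn
  -- from the `n`-th sequence.
  set G : ℕ → (ℕ → ℕ) → ℝ≥0∞ := fun n N => ∫⁻ p, ∫⁻ x, F (p, (N, x)) ∂Q ∂(ν n) with hG
  have hGm : ∀ n, Measurable (G n) := fun n => by
    have h1 : Measurable fun q : ((ℕ → ℕ) × X) × (ℕ → ℕ → X) => F (q.1.2, (q.1.1, q.2)) :=
      hF.comp (by fun_prop)
    exact (h1.lintegral_prod_right' (ν := Q)).lintegral_prod_right' (ν := ν n)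
  have hrow : ∀ n, ∫⁻ s, ∑' i, (if i < s.1 n then F (s.2 n i, removePoint n i s) else 0)
      ∂(A.prod Q) = ρ n * ∫⁻ N, G n N ∂A := fun n => by
    calc _ = ∑' i, ∫⁻ N, ∫⁻ x,
            (if i < N n then F (x n i, removePoint n i (N, x)) else 0) ∂Q ∂A := by
          rw [lintegral_tsum fun i => (hmeas n i).aemeasurable]
          exact tsum_congr fun i => lintegral_prod _ (hmeas n i).aemeasurable
      _ = ∑' i, ∫⁻ N, (if i < N n then G n (Function.update N n (N n - 1)) else 0) ∂A := by
          refine tsum_congr fun i => lintegral_congr fun N => ?_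
          split_ifs with h
          · exact lintegral_removeRow ν n i
              (fun q => F (q.1, (Function.update N n (N n - 1), q.2))) (hF.comp (by fun_prop))
          · simp
      _ = ∫⁻ N, N n * G n (Function.update N n (N n - 1)) ∂A := by
          rw [← lintegral_tsum]
          · refine lintegral_congr fun N => ?_
            rw [tsum_eq_sum (s := Finset.range (N n)) (fun i hi => by
              rw [if_neg (by simpa using hi)])]
            rw [Finset.sum_congr rfl (fun i hi => if_pos (Finset.mem_range.1 hi))]
            simp
          · intro i
            refine (Measurable.ite ?_ ((hGm n).comp ?_) measurable_const).aemeasurable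
            · exact (measurable_pi_apply n) (measurableSet_Ioi (a := i))
            · exact measurable_update_apply n measurable_id
                ((measurable_of_countable fun k : ℕ => k - 1).comp (measurable_pi_apply n))
      _ = ρ n * ∫⁻ N, G n N ∂A := by
          have hup : Measurable fun p : ℕ × (ℕ → ℕ) => Function.update p.2 n p.1 :=
            measurable_update_apply n measurable_snd measurable_fst
          have h1 : Measurable fun N : ℕ → ℕ =>
              (N n : ℝ≥0∞) * G n (Function.update N n (N n - 1)) :=
            (measurable_from_top.comp (measurable_pi_apply n)).mul ((hGm n).comp
              (measurable_update_apply n measurable_id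
                ((measurable_of_countable fun k : ℕ => k - 1).comp (measurable_pi_apply n))))
          conv_lhs => rw [hA, ← map_update_infinitePi _ n]
          conv_rhs => rw [hA, ← map_update_infinitePi _ n]
          have h2 : Measurable fun N : ℕ → ℕ =>
              ∫⁻ k, G n (Function.update N n k) ∂(poissonMeasure (ρ n)) :=
            ((hGm n).comp hup).lintegral_prod_left'
          rw [lintegral_map_prod_symm hup h1, lintegral_map_prod_symm hup (hGm n),
            ← lintegral_const_mul _ h2]
          refine lintegral_congr fun N => ?_
          simp only [Function.update_self, Function.update_idem]
          exact lintegral_natCast_mul_poissonMeasure (ρ n)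
            (fun k => G n (Function.update N n k))
  have hsum : ∀ H : X → ℝ≥0∞, ∫⁻ p, H p ∂Λ = ∑' n, ρ n * ∫⁻ p, H p ∂(ν n) := fun H => by
    conv_lhs => rw [← sum_sfiniteSeq Λ]
    rw [lintegral_sum_measure]
    refine tsum_congr fun n => ?_
    conv_lhs => rw [← smul_normalized (sfiniteSeq Λ n)]
    rw [lintegral_smul_measure, smul_eq_mul]
  rw [hP, lintegral_tsum fun n => (Measurable.tsum fun i => hmeas n i).aemeasurable, hsum]
  refine tsum_congr fun n => ?_
  rw [hrow n]
  congr 1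
  have h1 : Measurable fun q : (ℕ → ℕ) × X => ∫⁻ x, F (q.2, (q.1, x)) ∂Q := by
    have h1 : Measurable fun q : ((ℕ → ℕ) × X) × (ℕ → ℕ → X) => F (q.1.2, (q.1.1, q.2)) :=
      hF.comp (by fun_prop)
    exact h1.lintegral_prod_right'
  simp only [hG]
  rw [lintegral_lintegral_swap h1.aemeasurable]
  refine lintegral_congr fun p => ?_
  exact (lintegral_prod _ (hF.comp measurable_prodMk_left).aemeasurable).symm

end Mecke

/-! ### Self-avoiding chains of points of a Poisson process -/

section Chains

variable {X : Type*}

/-- `(q, s) ∈ chainFrom r k` if in the sample `s` there are `k` different points `p₁, …, p_k` such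
that each of `q, p₁, …, p_k` is related by `r` to the next one. That the points are different is
encoded by removing every point from the sample when it is used. -/
def chainFrom (r : X → X → Prop) : ℕ → Set (X × Sample X)
  | 0 => Set.univ
  | k + 1 => {q | ∃ n i, i < q.2.1 n ∧ r q.1 (q.2.2 n i) ∧
      (q.2.2 n i, removePoint n i q.2) ∈ chainFrom r k}

lemma chainFrom_antitone (r : X → X → Prop) : Antitone (chainFrom r) := by
  refine antitone_nat_of_succ_le fun k => ?_
  induction k with
  | zero => exact Set.subset_univ _
  | succ k ih =>
    rintro q ⟨n, i, hi, hr, hq⟩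
    exact ⟨n, i, hi, hr, ih hq⟩

/-- `reindex a b` is the index in `removePoint a.1 a.2 s` of the point which has the index `b ≠ a`
in `s`. -/
def reindex (a b : ℕ × ℕ) : ℕ × ℕ := if b.1 = a.1 then (b.1, unskip a.2 b.2) else b

lemma reindex_injOn (a : ℕ × ℕ) : Set.InjOn (reindex a) {b | b ≠ a} := by
  rintro ⟨n, i⟩ hb ⟨m, j⟩ hc h
  obtain ⟨u, v⟩ := a
  simp only [reindex, unskip, Set.mem_ofPred_eq, ne_eq, Prod.mk.injEq, not_and] at *
  grind

lemma removePoint_snd_reindex {s : Sample X} {a b : ℕ × ℕ} (h : b ≠ a) :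
    (removePoint a.1 a.2 s).2 (reindex a b).1 (reindex a b).2 = s.2 b.1 b.2 := by
  obtain ⟨u, v⟩ := a
  obtain ⟨n, i⟩ := b
  by_cases hn : n = u
  · subst hn
    have : i ≠ v := fun h' => h (by rw [h'])
    simp [removePoint, reindex, skip_unskip this]
  · simp [removePoint, reindex, hn]

lemma reindex_lt {s : Sample X} {a b : ℕ × ℕ} (h : b ≠ a) (ha : a.2 < s.1 a.1)
    (hb : b.2 < s.1 b.1) : (reindex a b).2 < (removePoint a.1 a.2 s).1 (reindex a b).1 := by
  obtain ⟨u, v⟩ := a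
  obtain ⟨n, i⟩ := b
  by_cases hn : n = u
  · subst hn
    have : i ≠ v := fun h' => h (by rw [h'])
    simp only [removePoint, reindex, if_true, Function.update_self, unskip]
    grind
  · simpa [removePoint, reindex, hn] using hb

/-- A list of different indices whose points are successively related is a chain in the sense of
`chainFrom`. -/
lemma mem_chainFrom_of_isChain (r : X → X → Prop) {k : ℕ} {l : List (ℕ × ℕ)} (hk : l.length = k)
    {a : ℕ × ℕ} {s : Sample X} (hs : ∀ b ∈ a :: l, b.2 < s.1 b.1) (hnd : (a :: l).Nodup)
    (hc : (a :: l).IsChain fun b c => r (s.2 b.1 b.2) (s.2 c.1 c.2)) :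
    (s.2 a.1 a.2, removePoint a.1 a.2 s) ∈ chainFrom r k := by
  induction k generalizing l a s with
  | zero => trivial
  | succ k ih =>
    obtain - | ⟨b, l⟩ := l
    · simp at hk
    have hne : ∀ c ∈ b :: l, c ≠ a := fun c hc h => (List.nodup_cons.1 hnd).1 (h ▸ hc)
    have hba := hne b (by simp)
    rw [List.isChain_cons_cons] at hc
    refine ⟨(reindex a b).1, (reindex a b).2, ?_, ?_, ?_⟩
    · exact reindex_lt hba (hs a (by simp)) (hs b (by simp))
    · dsimp only
      rw [removePoint_snd_reindex hba]
      exact hc.1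
    · refine ih (l := l.map (reindex a)) (by simpa using hk) (a := reindex a b) ?_ ?_ ?_
      · rw [← List.map_cons]
        intro c hc'
        obtain ⟨d, hd, rfl⟩ := List.mem_map.1 hc'
        exact reindex_lt (hne d hd) (hs a (by simp)) (hs d (List.mem_cons_of_mem _ hd))
      · rw [← List.map_cons]
        exact (List.nodup_cons.1 hnd).2.map_on fun c hc' d hd =>
          reindex_injOn a (hne c hc') (hne d hd)
      · rw [← List.map_cons, List.isChain_map]
        refine hc.2.imp_of_mem_imp fun c d hc' hd h => ?_
        rw [removePoint_snd_reindex (hne c hc'), removePoint_snd_reindex (hne d hd)]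
        exact h

end Chains

section Moments

variable {X : Type*} [MeasurableSpace X]

lemma measurableSet_chainFrom {r : X → X → Prop} (hr : MeasurableSet {p : X × X | r p.1 p.2})
    (k : ℕ) : MeasurableSet (chainFrom r k) := by
  induction k with
  | zero => exact .univ
  | succ k ih =>
    have : chainFrom r (k + 1) = ⋃ n, ⋃ i, {q | i < q.2.1 n} ∩
        ({q | r q.1 (q.2.2 n i)} ∩ {q | (q.2.2 n i, removePoint n i q.2) ∈ chainFrom r k}) := by
      ext q
      simp [chainFrom]
    rw [this]
    refine .iUnion fun n => .iUnion fun i => ?_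
    have h1 : Measurable fun q : X × Sample X => q.2.1 n :=
      (measurable_pi_apply n).comp (measurable_fst.comp measurable_snd)
    have h2 : Measurable fun q : X × Sample X => q.2.2 n i :=
      (measurable_pi_apply i).comp ((measurable_pi_apply n).comp
        (measurable_snd.comp measurable_snd))
    refine (h1 (measurableSet_Ioi (a := i))).inter (.inter ?_ ?_)
    · exact (measurable_fst.prodMk h2) hr
    · exact (h2.prodMk ((measurable_removePoint n i).comp measurable_snd)) ih

lemma measurableSet_related {r : X → X → Prop} (hr : MeasurableSet {p : X × X | r p.1 p.2})
    (q : X) : MeasurableSet {p | r q p} :=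
  measurable_prodMk_left hr

variable [Nonempty X] (Λ : Measure X) [SFinite Λ]

instance : IsProbabilityMeasure (poissonProcessMeasure Λ) := by
  unfold poissonProcessMeasure; infer_instance

/-- The union bound for a property of a point and of the rest of the process. -/
lemma measure_exists_removePoint_le {B : Set (X × Sample X)} (hB : MeasurableSet B) :
    poissonProcessMeasure Λ {s | ∃ n i, i < s.1 n ∧ (s.2 n i, removePoint n i s) ∈ B}
      ≤ ∫⁻ p, poissonProcessMeasure Λ {s | (p, s) ∈ B} ∂Λ := by
  have hF : Measurable (B.indicator (1 : X × Sample X → ℝ≥0∞)) := measurable_one.indicator hB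
  have h := lintegral_tsum_removePoint Λ _ hF
  have h2 : ∀ p, ∫⁻ s, B.indicator (1 : X × Sample X → ℝ≥0∞) (p, s) ∂(poissonProcessMeasure Λ)
      = poissonProcessMeasure Λ {s | (p, s) ∈ B} := fun p => by
    have : MeasurableSet {s | (p, s) ∈ B} := measurable_prodMk_left hB
    rw [← lintegral_indicator_one this]
    rfl
  simp only [h2] at h
  rw [← h]
  have hm : Measurable fun s : Sample X => ∑' n, ∑' i,
      (if i < s.1 n then B.indicator (1 : X × Sample X → ℝ≥0∞) (s.2 n i, removePoint n i s)
        else 0) :=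
    Measurable.tsum fun n => Measurable.tsum fun i => measurable_removePoint_summand hF n i
  have hM := meas_ge_le_lintegral_div (μ := poissonProcessMeasure Λ) hm.aemeasurable one_ne_zero
    ENNReal.one_ne_top
  rw [div_one] at hM
  refine (measure_mono ?_).trans hM
  rintro s ⟨n, i, hi, hs⟩
  refine le_trans ?_ (ENNReal.le_tsum n)
  refine le_trans ?_ (ENNReal.le_tsum i)
  simp [hi, hs]

/-- If every point has in the mean at most `m` related points, then the probability that a chain of
`k` points starts next to a given point is at most `m ^ k`. -/
lemma measure_chainFrom_le {r : X → X → Prop} (hr : MeasurableSet {p : X × X | r p.1 p.2})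
    {m : ℝ≥0∞} (hm : ∀ q, Λ {p | r q p} ≤ m) (k : ℕ) (q : X) :
    poissonProcessMeasure Λ {s | (q, s) ∈ chainFrom r k} ≤ m ^ k := by
  induction k generalizing q with
  | zero => simpa using prob_le_one
  | succ k ih =>
    have hrq : MeasurableSet {p | r q p} := measurableSet_related hr q
    have h := measure_exists_removePoint_le Λ (B := {p | r q p.1} ∩ chainFrom r k)
      ((measurable_fst hrq).inter (measurableSet_chainFrom hr k))
    refine h.trans ?_
    calc _ ≤ ∫⁻ p, {p | r q p}.indicator (fun _ => m ^ k) p ∂Λ := by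
          refine lintegral_mono fun p => ?_
          by_cases hp : r q p
          · simpa [hp] using ih p
          · simp [hp]
      _ = m ^ k * Λ {p | r q p} := lintegral_indicator_const hrq _
      _ ≤ m ^ (k + 1) := by rw [pow_succ]; gcongr; exact hm q

/-- Almost surely, only finitely many points of the process lie in a set of finite intensity. -/
lemma ae_finite_points {B : Set X} (hB : MeasurableSet B) (hfin : Λ B ≠ ∞) :
    ∀ᵐ s ∂(poissonProcessMeasure Λ), {a : ℕ × ℕ | a.2 < s.1 a.1 ∧ s.2 a.1 a.2 ∈ B}.Finite := by
  have hF : Measurable ((Prod.fst ⁻¹' B).indicator (1 : X × Sample X → ℝ≥0∞)) :=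
    measurable_one.indicator (measurable_fst hB)
  have h := lintegral_tsum_removePoint Λ _ hF
  have h2 : ∫⁻ p, ∫⁻ s, (Prod.fst ⁻¹' B).indicator (1 : X × Sample X → ℝ≥0∞) (p, s)
      ∂(poissonProcessMeasure Λ) ∂Λ = Λ B := by
    rw [← lintegral_indicator_one hB]
    refine lintegral_congr fun p => ?_
    by_cases hp : p ∈ B <;> simp [hp, Set.indicator]
  rw [h2] at h
  have hm : Measurable fun s : Sample X => ∑' n, ∑' i, (if i < s.1 n then
      (Prod.fst ⁻¹' B).indicator (1 : X × Sample X → ℝ≥0∞) (s.2 n i, removePoint n i s) else 0) :=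
    Measurable.tsum fun n => Measurable.tsum fun i => measurable_removePoint_summand hF n i
  filter_upwards [ae_lt_top hm (h ▸ hfin)] with s hs
  rw [← ENNReal.tsum_prod] at hs
  refine (ENNReal.finite_const_le_of_tsum_ne_top hs.ne one_ne_zero).subset ?_
  rintro ⟨n, i⟩ ⟨hi, hB'⟩
  simp_all

/-- If every point has in the mean at most `m < 1` related points, then almost surely there is a
bound on the lengths of the self-avoiding chains that start in a given set of finite intensity. -/
lemma ae_exists_notMem_chainFrom {r : X → X → Prop}
    (hr : MeasurableSet {p : X × X | r p.1 p.2}) {m : ℝ≥0∞} (hm1 : m < 1)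
    (hm : ∀ q, Λ {p | r q p} ≤ m) {B : Set X} (hB : MeasurableSet B) (hfin : Λ B ≠ ∞) :
    ∀ᵐ s ∂(poissonProcessMeasure Λ), ∃ k, ∀ n i, i < s.1 n → s.2 n i ∈ B →
      (s.2 n i, removePoint n i s) ∉ chainFrom r k := by
  have hk : ∀ k, poissonProcessMeasure Λ {s | ¬ ∃ k, ∀ n i, i < s.1 n → s.2 n i ∈ B →
      (s.2 n i, removePoint n i s) ∉ chainFrom r k} ≤ Λ B * m ^ k := fun k => by
    calc _ ≤ poissonProcessMeasure Λ {s | ∃ n i, i < s.1 n ∧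
            (s.2 n i, removePoint n i s) ∈ (Prod.fst ⁻¹' B) ∩ chainFrom r k} := by
          refine measure_mono fun s hs => ?_
          simp only [Set.mem_ofPred_eq] at hs
          push Not at hs
          obtain ⟨n, i, h1, h2, h3⟩ := hs k
          exact ⟨n, i, h1, h2, h3⟩
      _ ≤ _ := measure_exists_removePoint_le Λ
          ((measurable_fst hB).inter (measurableSet_chainFrom hr k))
      _ ≤ ∫⁻ p, B.indicator (fun _ => m ^ k) p ∂Λ := by
          refine lintegral_mono fun p => ?_
          by_cases hp : p ∈ B
          · simpa [hp] using measure_chainFrom_le Λ hr hm k p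
          · simp [hp]
      _ = Λ B * m ^ k := by rw [lintegral_indicator_const hB, mul_comm]
  have hlim : Filter.Tendsto (fun k => Λ B * m ^ k) Filter.atTop (nhds 0) := by
    simpa using ENNReal.Tendsto.const_mul (ENNReal.tendsto_pow_atTop_nhds_zero_of_lt_one hm1)
      (Or.inr hfin)
  exact le_antisymm (ge_of_tendsto' hlim hk) zero_le

end Moments

/-! ### Hyperbolic area in Euclidean coordinates -/

lemma coe_polar (r t : ℝ) :
    (polar r t : ℂ) = (Real.tanh (r / 2) : ℂ) * Complex.exp (t * Complex.I) := rfl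

lemma coe_translation (x z : H2) :
    (translation x z : ℂ) = ((z : ℂ) + x) / (1 + conj (x : ℂ) * z) := rfl

lemma measurable_coe : Measurable fun x : H2 => (x : ℂ) :=
  Complex.UnitDisc.continuous_coe.measurable

lemma one_sub_tanh_sq_pos (r : ℝ) : 0 < 1 - Real.tanh r ^ 2 := by
  have := (sq_lt_one_iff_abs_lt_one _).2 (Real.abs_tanh_lt_one r)
  linarith

lemma hasDerivAt_tanh_half (r : ℝ) :
    HasDerivAt (fun r => Real.tanh (r / 2)) ((1 - Real.tanh (r / 2) ^ 2) / 2) r := by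
  have h1 : HasDerivAt Real.tanh (1 - Real.tanh (r / 2) ^ 2) (r / 2) := by
    have h := (Real.hasDerivAt_sinh (r / 2)).div (Real.hasDerivAt_cosh (r / 2))
      (Real.cosh_pos _).ne'
    have hf : Real.tanh = Real.sinh / Real.cosh := by
      funext x; exact Real.tanh_eq_sinh_div_cosh x
    rw [hf]
    refine h.congr_deriv ?_
    have := (Real.cosh_pos (r / 2)).ne'
    simp only [Pi.div_apply]
    field_simp
  simpa [div_eq_mul_inv, Function.comp_def] using h1.comp r ((hasDerivAt_id r).div_const 2)

lemma sinh_mul_one_sub_tanh_half_sq (r : ℝ) :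
    Real.sinh r * (1 - Real.tanh (r / 2) ^ 2) = 2 * Real.tanh (r / 2) := by
  have h1 : Real.sinh r = 2 * Real.sinh (r / 2) * Real.cosh (r / 2) := by
    rw [← Real.sinh_two_mul]; congr 1; ring
  rw [h1, Real.tanh_eq_sinh_div_cosh]
  have := (Real.cosh_pos (r / 2)).ne'
  have h2 := Real.cosh_sq (r / 2)
  field_simp
  rw [h2]; ring

lemma tanh_half_image_Ioi : (fun r => Real.tanh (r / 2)) '' Set.Ioi 0 = Set.Ioo 0 1 := by
  ext y
  constructor
  · rintro ⟨r, hr, rfl⟩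
    refine ⟨?_, Real.tanh_lt_one _⟩
    have hr' : 0 < r / 2 := half_pos hr
    simp only [Real.tanh_eq_sinh_div_cosh]
    exact div_pos (Real.sinh_pos_iff.2 hr') (Real.cosh_pos _)
  · rintro ⟨h0, h1⟩
    have hy : y ∈ Set.Ioo (-1 : ℝ) 1 := ⟨by linarith, h1⟩
    refine ⟨2 * Real.artanh y, ?_, ?_⟩
    · have := Real.artanh_pos ⟨h0, h1⟩
      simpa using this
    · have : 2 * Real.artanh y / 2 = Real.artanh y := by ring
      simp only [this, Real.tanh_artanh hy]

/-- Integrals over a full turn do not depend on where the turn starts. -/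
lemma lintegral_Ico_exp_mul_I (f : ℂ → ℝ≥0∞) :
    ∫⁻ t in Set.Ico 0 (2 * Real.pi), f (Complex.exp (t * Complex.I))
      = ∫⁻ t in Set.Ioo (-Real.pi) Real.pi, f (Complex.exp (t * Complex.I)) := by
  have hp : Function.Periodic (fun t : ℝ => f (Complex.exp (t * Complex.I))) (2 * Real.pi) := by
    intro t
    simp only
    congr 1
    push_cast
    rw [add_mul, Complex.exp_periodic]
  have : Fact (0 < 2 * Real.pi) := ⟨Real.two_pi_pos⟩
  have h := fun t => AddCircle.lintegral_preimage (2 * Real.pi) t hp.lift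
  simp only [Function.Periodic.lift_coe] at h
  rw [setLIntegral_congr Ico_ae_eq_Ioc, setLIntegral_congr Ioo_ae_eq_Ioc]
  have h0 := h 0
  have h1 := h (-Real.pi)
  rw [zero_add] at h0
  rw [show -Real.pi + 2 * Real.pi = Real.pi by ring] at h1
  rw [h0, h1]

/-- The density of the hyperbolic area with respect to the Lebesgue measure of the disc. -/
noncomputable def areaDensity (z : ℂ) : ℝ := 4 / (1 - ‖z‖ ^ 2) ^ 2

lemma measurable_areaDensity : Measurable areaDensity := by
  unfold areaDensity; fun_prop

lemma lintegral_hypArea_polar {g : ℂ → ℝ≥0∞} (hg : Measurable g) :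
    ∫⁻ x : H2, g x ∂hypArea = ∫⁻ r in Set.Ioi 0, ∫⁻ t in Set.Ico 0 (2 * Real.pi),
      ENNReal.ofReal (Real.sinh r) * g (Real.tanh (r / 2) * Complex.exp (t * Complex.I)) := by
  have hgp : Measurable fun p : ℝ × ℝ => g (polar p.1 p.2) :=
    hg.comp (measurable_coe.comp measurable_polar)
  have hs : Measurable fun p : ℝ × ℝ => ENNReal.ofReal (Real.sinh p.1) :=
    (Real.measurable_sinh.comp measurable_fst).ennreal_ofReal
  rw [hypArea, lintegral_map (f := fun x : H2 => g x) (hg.comp measurable_coe) measurable_polar,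
    lintegral_withDensity_eq_lintegral_mul _ hs hgp, lintegral_prod _ (hs.mul hgp).aemeasurable,
    setLIntegral_congr Ioi_ae_eq_Ici.symm]
  rfl

/-- The hyperbolic area in Euclidean coordinates. -/
theorem lintegral_hypArea {g : ℂ → ℝ≥0∞} (hg : Measurable g) :
    ∫⁻ x : H2, g x ∂hypArea
      = ∫⁻ z in Metric.ball 0 1, ENNReal.ofReal (areaDensity z) * g z := by
  set G : ℝ → ℝ≥0∞ := fun ρ => ∫⁻ t in Set.Ioo (-Real.pi) Real.pi,
    g (ρ * Complex.exp (t * Complex.I)) with hG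
  have hleft : ∫⁻ x : H2, g x ∂hypArea = ∫⁻ r in Set.Ioi 0,
      ENNReal.ofReal |(1 - Real.tanh (r / 2) ^ 2) / 2| *
        (ENNReal.ofReal (Real.tanh (r / 2) * areaDensity (Real.tanh (r / 2) : ℝ))
          * G (Real.tanh (r / 2))) := by
    rw [lintegral_hypArea_polar hg]
    refine setLIntegral_congr_fun measurableSet_Ioi fun r hr => ?_
    have h1 := one_sub_tanh_sq_pos (r / 2)
    rw [lintegral_const_mul' _ _ ENNReal.ofReal_ne_top,
      lintegral_Ico_exp_mul_I (fun u => g (Real.tanh (r / 2) * u)), ← mul_assoc,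
      ← ENNReal.ofReal_mul (abs_nonneg _), abs_of_nonneg (by positivity)]
    congr 2
    rw [areaDensity, Complex.norm_real, Real.norm_eq_abs, sq_abs]
    have h2 := sinh_mul_one_sub_tanh_half_sq r
    field_simp
    linarith
  have hinj : Set.InjOn (fun r => Real.tanh (r / 2)) (Set.Ioi 0) := fun a _ b _ h => by
    have := Real.tanh_injective h
    linarith
  rw [hleft, ← lintegral_image_eq_lintegral_abs_deriv_mul measurableSet_Ioi
    (fun r _ => (hasDerivAt_tanh_half r).hasDerivWithinAt) hinj
    (fun ρ => ENNReal.ofReal (ρ * areaDensity (ρ : ℝ)) * G ρ), tanh_half_image_Ioi]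
  have hF : Measurable fun z : ℂ => (Metric.ball (0 : ℂ) 1).indicator
      (fun z => ENNReal.ofReal (areaDensity z) * g z) z :=
    ((measurable_areaDensity.ennreal_ofReal).mul hg).indicator measurableSet_ball
  rw [← lintegral_indicator measurableSet_ball, ← Complex.lintegral_comp_polarCoord_symm,
    polarCoord_target, Measure.volume_eq_prod, ← Measure.prod_restrict]
  have hpc : Measurable fun p : ℝ × ℝ => Complex.polarCoord.symm p := by
    simp only [Complex.polarCoord_symm_apply]
    fun_prop
  have hFm : Measurable fun p : ℝ × ℝ => ENNReal.ofReal p.1 • (Metric.ball (0 : ℂ) 1).indicator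
      (fun z => ENNReal.ofReal (areaDensity z) * g z) (Complex.polarCoord.symm p) :=
    measurable_fst.ennreal_ofReal.smul (hF.comp hpc)
  rw [lintegral_prod _ hFm.aemeasurable]
  rw [← Set.Ioi_inter_Iio, Set.inter_comm, ← setLIntegral_indicator measurableSet_Iio]
  refine setLIntegral_congr_fun measurableSet_Ioi fun ρ hρ => ?_
  have hρ' : (0 : ℝ) < ρ := hρ
  have hpol : ∀ t : ℝ, Complex.polarCoord.symm (ρ, t) = ρ * Complex.exp (t * Complex.I) :=
    fun t => by rw [Complex.polarCoord_symm_apply, Complex.exp_mul_I]; simp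
  have hn : ∀ t : ℝ, ‖(ρ : ℂ) * Complex.exp (t * Complex.I)‖ = ρ := fun t => by
    rw [norm_mul, Complex.norm_exp_ofReal_mul_I, mul_one, Complex.norm_real, Real.norm_eq_abs,
      abs_of_pos hρ']
  simp only [hpol, smul_eq_mul, Set.indicator, Metric.mem_ball, dist_zero_right, hn, Set.mem_Iio]
  split_ifs with h
  · rw [ENNReal.ofReal_mul hρ'.le, mul_assoc, hG, ← lintegral_const_mul' _ _ ENNReal.ofReal_ne_top,
      ← lintegral_const_mul' _ _ ENNReal.ofReal_ne_top]
    refine lintegral_congr fun t => ?_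
    simp only [areaDensity, hn, Complex.norm_real, Real.norm_eq_abs, sq_abs]
  · simp

/-! ### Invariance of the hyperbolic area under translations -/

lemma one_add_conj_mul_ne_zero (x z : H2) : 1 + conj (x : ℂ) * z ≠ 0 := by
  intro h
  have h1 : ‖conj (x : ℂ) * z‖ = 1 := by
    rw [← norm_neg, ← eq_neg_of_add_eq_zero_left h, norm_one]
  rw [norm_mul, RCLike.norm_conj] at h1
  have := mul_lt_one_of_nonneg_of_lt_one_left (norm_nonneg _) x.norm_lt_one z.norm_lt_one.le
  linarith

lemma translation_neg_translation (x z : H2) : translation (-x) (translation x z) = z := by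
  apply Complex.UnitDisc.coe_injective
  have h1 := one_add_conj_mul_ne_zero x z
  have h2 := one_add_conj_mul_ne_zero (-x) (translation x z)
  have h3 : (translation x z : ℂ) * (1 + conj (x : ℂ) * z) = z + x := div_mul_cancel₀ _ h1
  rw [coe_translation, div_eq_iff h2]
  simp only [Complex.UnitDisc.coe_neg, map_neg]
  linear_combination h3

lemma translation_translation_neg (x z : H2) : translation x (translation (-x) z) = z := by
  have := translation_neg_translation (-x) z
  rwa [neg_neg] at this

lemma one_sub_norm_sq_translation (x z : H2) :
    1 - ‖(translation x z : ℂ)‖ ^ 2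
      = (1 - ‖(x : ℂ)‖ ^ 2) * (1 - ‖(z : ℂ)‖ ^ 2) / ‖1 + conj (x : ℂ) * z‖ ^ 2 := by
  have h : ‖1 + conj (x : ℂ) * z‖ ^ 2 ≠ 0 := by
    have := one_add_conj_mul_ne_zero x z
    positivity
  rw [coe_translation, norm_div, div_pow, eq_div_iff h, sub_mul, div_mul_cancel₀ _ h, one_mul]
  simp only [← Complex.normSq_eq_norm_sq, Complex.normSq_apply, Complex.add_re, Complex.add_im,
    Complex.mul_re, Complex.mul_im, Complex.conj_re, Complex.conj_im, Complex.one_re,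
    Complex.one_im]
  ring

lemma continuous_translation : Continuous fun p : H2 × H2 => translation p.1 p.2 := by
  rw [Complex.UnitDisc.isEmbedding_coe.continuous_iff]
  have h1 : Continuous fun p : H2 × H2 => (p.1 : ℂ) :=
    Complex.UnitDisc.continuous_coe.comp continuous_fst
  have h2 : Continuous fun p : H2 × H2 => (p.2 : ℂ) :=
    Complex.UnitDisc.continuous_coe.comp continuous_snd
  exact (h2.add h1).div (continuous_const.add ((Complex.continuous_conj.comp h1).mul h2))
    fun p => one_add_conj_mul_ne_zero p.1 p.2

lemma hasDerivAt_translation (x z : H2) :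
    HasDerivAt (fun w : ℂ => (w + x) / (1 + conj (x : ℂ) * w))
      ((1 - ‖(x : ℂ)‖ ^ 2 : ℝ) / (1 + conj (x : ℂ) * z) ^ 2) z := by
  have h := one_add_conj_mul_ne_zero x z
  have h1 : HasDerivAt (fun w : ℂ => w + x) 1 z := (hasDerivAt_id _).add_const _
  have h2 : HasDerivAt (fun w : ℂ => 1 + conj (x : ℂ) * w) (conj (x : ℂ)) z := by
    simpa using ((hasDerivAt_id (z : ℂ)).const_mul (conj (x : ℂ))).const_add 1
  refine (h1.div h2 h).congr_deriv ?_
  congr 1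
  have : ((‖(x : ℂ)‖ ^ 2 : ℝ) : ℂ) = conj (x : ℂ) * x := by
    rw [← Complex.normSq_eq_norm_sq, Complex.normSq_eq_conj_mul_self]
  push_cast at this ⊢
  rw [this]
  ring

/-- Translations preserve the hyperbolic area. -/
theorem map_translation_hypArea (x : H2) : hypArea.map (translation x) = hypArea := by
  have hT : Measurable (translation x) :=
    (continuous_translation.comp (Continuous.prodMk_right x)).measurable
  -- It suffices to test against functions of the Euclidean coordinate.
  suffices H : ∀ g : ℂ → ℝ≥0∞, Measurable g →
      ∫⁻ z : H2, g (translation x z) ∂hypArea = ∫⁻ z : H2, g z ∂hypArea by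
    have hemb : MeasurableEmbedding fun x : H2 => (x : ℂ) :=
      Complex.UnitDisc.isEmbedding_coe.measurableEmbedding (by
        have : Set.range (fun x : H2 => (x : ℂ)) = Metric.ball 0 1 := Subtype.range_coe
        rw [this]
        exact measurableSet_ball)
    ext A hA
    rw [Measure.map_apply hT hA, ← lintegral_indicator_one hA, ← lintegral_indicator_one (hT hA)]
    have hA' : MeasurableSet ((fun x : H2 => (x : ℂ)) '' A) := hemb.measurableSet_image.2 hA
    have h := H _ (measurable_one.indicator hA')
    have hind : ∀ z : H2, ((fun x : H2 => (x : ℂ)) '' A).indicator (1 : ℂ → ℝ≥0∞) z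
        = A.indicator 1 z := fun z => by
      by_cases hz : z ∈ A
      · simp [hz]
      · have : (z : ℂ) ∉ ((fun x : H2 => (x : ℂ)) '' A) := by
          rintro ⟨y, hy, hyz⟩
          exact hz (Complex.UnitDisc.coe_injective hyz ▸ hy)
        rw [Set.indicator_of_notMem hz, Set.indicator_of_notMem this]
    simp only [hind] at h
    exact h
  intro g hg
  set T : ℂ → ℂ := fun w => (w + x) / (1 + conj (x : ℂ) * w) with hTdef
  have hTm : Measurable T := by fun_prop
  have h1 : ∫⁻ z : H2, g (translation x z) ∂hypArea
      = ∫⁻ z : H2, (g ∘ T) z ∂hypArea := rfl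
  rw [h1, lintegral_hypArea (hg.comp hTm), lintegral_hypArea hg]
  let D (w : ℂ) (hw : w ∈ Metric.ball (0 : ℂ) 1) : H2 := .mk w (mem_ball_zero_iff.1 hw)
  have himage : T '' Metric.ball 0 1 = Metric.ball 0 1 := by
    ext w
    constructor
    · rintro ⟨z, hz, rfl⟩
      exact (translation x (D z hz)).2
    · intro hw
      exact ⟨translation (-x) (D w hw), (translation (-x) (D w hw)).2,
        congrArg (fun z : H2 => (z : ℂ)) (translation_translation_neg x (D w hw))⟩
  have hinj : Set.InjOn T (Metric.ball 0 1) := fun a ha b hb h => by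
    have h' : translation x (D a ha) = translation x (D b hb) :=
      Complex.UnitDisc.coe_injective h
    have := congrArg (translation (-x)) h'
    rw [translation_neg_translation, translation_neg_translation] at this
    exact congrArg (fun z : H2 => (z : ℂ)) this
  conv_rhs => rw [← himage]
  rw [lintegral_image_eq_lintegral_abs_det_fderiv_mul volume measurableSet_ball
    (f' := fun z => (ContinuousLinearMap.toSpanSingleton ℂ
      ((1 - ‖(x : ℂ)‖ ^ 2 : ℝ) / (1 + conj (x : ℂ) * z) ^ 2)).restrictScalars ℝ)
    (fun z hz => ((hasDerivAt_translation x (D z hz)).hasFDerivAt.restrictScalars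
      ℝ).hasFDerivWithinAt) hinj]
  refine setLIntegral_congr_fun measurableSet_ball fun z hz => ?_
  rw [← mul_assoc, ← ENNReal.ofReal_mul (abs_nonneg _)]
  refine congrArg₂ (· * ·) (congrArg ENNReal.ofReal ?_) rfl
  have hn := one_sub_norm_sq_translation x (D z hz)
  have hne := one_add_conj_mul_ne_zero x (D z hz)
  rw [coe_translation] at hn
  simp only [D, Complex.UnitDisc.coe_mk] at hn hne
  have hx : 0 < 1 - ‖(x : ℂ)‖ ^ 2 := by linarith [x.sq_norm_lt_one]
  have hzz : 0 < 1 - ‖z‖ ^ 2 := by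
    have := (Complex.UnitDisc.mk z (mem_ball_zero_iff.1 hz)).sq_norm_lt_one
    rw [Complex.UnitDisc.coe_mk] at this
    linarith
  have hdet : |((ContinuousLinearMap.toSpanSingleton ℂ
      (((1 - ‖(x : ℂ)‖ ^ 2 : ℝ) : ℂ) / (1 + conj (x : ℂ) * z) ^ 2)).restrictScalars ℝ).det|
      = (1 - ‖(x : ℂ)‖ ^ 2) ^ 2 / ‖1 + conj (x : ℂ) * z‖ ^ 4 := by
    simp only [ContinuousLinearMap.det, ContinuousLinearMap.coe_restrictScalars,
      LinearMap.det_restrictScalars, Algebra.norm_complex_eq]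
    simp [-Complex.ofReal_sub, -Complex.ofReal_pow, Complex.normSq_eq_norm_sq, ← pow_mul]
    positivity
  rw [hdet, areaDensity, areaDensity, hn]
  have : 0 < ‖1 + conj (x : ℂ) * z‖ := norm_pos_iff.2 hne
  field_simp

/-! ### The directions in which a curve is seen -/

/-- Reducing a set of angles modulo `π` does not increase its length. -/
lemma volume_mod_pi_le (E : Set ℝ) :
    volume {φ | φ ∈ Set.Ico 0 Real.pi ∧ ∃ k : ℤ, φ + k * Real.pi ∈ E} ≤ volume E := by
  rw [← measure_toMeasurable E]
  set F := toMeasurable volume E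
  have hF : MeasurableSet F := measurableSet_toMeasurable _ _
  set I : ℤ → Set ℝ := fun k => Set.Ico (k • Real.pi) ((k + 1) • Real.pi) with hI
  have hIm : ∀ k, MeasurableSet (I k) := fun k => measurableSet_Ico
  have hsub : {φ | φ ∈ Set.Ico 0 Real.pi ∧ ∃ k : ℤ, φ + k * Real.pi ∈ E}
      ⊆ ⋃ k : ℤ, (fun φ => φ + k * Real.pi) ⁻¹' (F ∩ I k) := by
    rintro φ ⟨hφ, k, hk⟩
    refine Set.mem_iUnion.2 ⟨k, subset_toMeasurable _ _ hk, ?_, ?_⟩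
    · simp only [zsmul_eq_mul]
      linarith [hφ.1]
    · simp only [zsmul_eq_mul]
      push_cast
      linarith [hφ.2]
  have hdisj : Pairwise (Function.onFun Disjoint fun k => F ∩ I k) := fun i j hij =>
    (Set.pairwise_disjoint_Ico_zsmul Real.pi hij).mono Set.inter_subset_right Set.inter_subset_right
  calc _ ≤ ∑' k : ℤ, volume ((fun φ => φ + k * Real.pi) ⁻¹' (F ∩ I k)) :=
        (measure_mono hsub).trans (measure_iUnion_le _)
    _ = ∑' k : ℤ, volume (F ∩ I k) := tsum_congr fun k => measure_preimage_add_right _ _ _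
    _ = volume (⋃ k, F ∩ I k) := (measure_iUnion hdisj fun k => hF.inter (hIm k)).symm
    _ ≤ volume F := measure_mono (Set.iUnion_subset fun k => Set.inter_subset_left)

lemma exists_int_arg_sub {u : ℂ} (hu : u ≠ 0) {ρ θ : ℝ}
    (h : (ρ : ℂ) * Complex.exp (θ * Complex.I) = u) :
    ∃ k : ℤ, θ + k * Real.pi = Complex.arg u := by
  have h1 : (‖u‖ : ℂ) * Complex.exp ((Complex.arg u - θ : ℝ) * Complex.I) = ρ := by
    rw [Complex.ofReal_sub, sub_mul, Complex.exp_sub, ← mul_div_assoc,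
      Complex.norm_mul_exp_arg_mul_I, ← h, mul_div_cancel_right₀ _ (Complex.exp_ne_zero _)]
  have h2 := congrArg Complex.im h1
  rw [Complex.im_ofReal_mul, Complex.exp_ofReal_mul_I_im,
    Complex.ofReal_im] at h2
  have h3 := (mul_eq_zero.1 h2).resolve_left (norm_ne_zero_iff.2 hu)
  obtain ⟨k, hk⟩ := Real.sin_eq_zero_iff.1 h3
  exact ⟨k, by linarith⟩

lemma hasDerivAt_arg {w : ℝ → ℂ} {w' : ℂ} {s : ℝ} (h : HasDerivAt w w' s)
    (hs : w s ∈ Complex.slitPlane) :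
    HasDerivAt (fun t => Complex.arg (w t)) (w' / w s).im s := by
  have := Complex.imCLM.hasFDerivAt.comp_hasDerivAt s (h.clog_real hs)
  simpa [Function.comp_def, Complex.log_im] using this

lemma volume_arg_image_le {w w' : ℝ → ℂ} (hw : ∀ s, HasDerivAt w (w' s) s) {S : Set ℝ}
    (hS : MeasurableSet S) (hslit : ∀ s ∈ S, w s ∈ Complex.slitPlane) (c : ℝ) :
    volume ((fun s => Complex.arg (w s) - c) '' S)
      ≤ ∫⁻ s in S, ENNReal.ofReal |(w' s / w s).im| := by
  have h := addHaar_image_le_lintegral_abs_det_fderiv (μ := volume) hS (fun s hs =>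
    ((hasDerivAt_arg (hw s) (hslit s hs)).sub_const c).hasFDerivAt.hasFDerivWithinAt)
  simpa only [ContinuousLinearMap.det_toSpanSingleton] using h

/-- The directions (modulo `π`) in which the part `S` of a curve `w` that avoids the origin is seen
from the origin have at most the total variation of the argument of `w` as their length. -/
lemma volume_directions_le {w w' : ℝ → ℂ} (hw : ∀ s, HasDerivAt w (w' s) s) {S : Set ℝ}
    (hS : MeasurableSet S) (h0 : ∀ s ∈ S, w s ≠ 0) (c : ℝ) :
    volume {φ | φ ∈ Set.Ico 0 Real.pi ∧
        ∃ s ∈ S, ∃ ρ : ℝ, (ρ : ℂ) * Complex.exp ((φ + c : ℝ) * Complex.I) = w s}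
      ≤ ∫⁻ s in S, ENNReal.ofReal |(w' s / w s).im| := by
  have hwm : Measurable w :=
    (continuous_iff_continuousAt.2 fun s => (hw s).continuousAt).measurable
  set U : Set ℝ := w ⁻¹' Complex.slitPlane
  have hU : MeasurableSet U := hwm Complex.isOpen_slitPlane.measurableSet
  have h1 := volume_arg_image_le hw (hS.inter hU) (fun s hs => hs.2) c
  -- On the negative real axis, where the argument jumps, the opposite curve is used instead.
  have h2 := volume_arg_image_le (w := fun s => -w s) (fun s => (hw s).neg) (hS.diff hU)
    (fun s hs => (Complex.mem_slitPlane_or_neg_mem_slitPlane (h0 s hs.1)).resolve_left hs.2) c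
  simp only [neg_div_neg_eq] at h2
  refine le_trans ?_ ((volume_mod_pi_le _).trans ((measure_union_le _ _).trans
    ((add_le_add h1 h2).trans_eq (lintegral_inter_add_sdiff _ S hU))))
  refine measure_mono ?_
  rintro φ ⟨hφ, s, hs, ρ, hρ⟩
  refine ⟨hφ, ?_⟩
  by_cases hsU : s ∈ U
  · obtain ⟨k, hk⟩ := exists_int_arg_sub (h0 s hs) hρ
    exact ⟨k, Or.inl ⟨s, ⟨hs, hsU⟩, by simp only; linarith⟩⟩
  · have hρ' : ((-ρ : ℝ) : ℂ) * Complex.exp ((φ + c : ℝ) * Complex.I) = -w s := by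
      rw [← hρ]; push_cast; ring
    obtain ⟨k, hk⟩ := exists_int_arg_sub (neg_ne_zero.2 (h0 s hs)) hρ'
    exact ⟨k, Or.inr ⟨s, ⟨hs, hsU⟩, by simp only; linarith⟩⟩

/-! ### Sticks as curves -/

lemma tanh_le_tanh_iff {a b : ℝ} : Real.tanh a ≤ Real.tanh b ↔ a ≤ b := by
  constructor
  · intro h
    have := Real.artanh_le_artanh (Real.neg_one_lt_tanh a) (Real.tanh_lt_one b) h
    rwa [Real.artanh_tanh, Real.artanh_tanh] at this
  · intro h
    by_contra! h'
    have := Real.artanh_lt_artanh (Real.neg_one_lt_tanh b) (Real.tanh_lt_one a) h'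
    rw [Real.artanh_tanh, Real.artanh_tanh] at this
    linarith

/-- The point at signed distance `s` from the centre on the geodesic which carries the stick `q`,
parametrized by arc length. -/
noncomputable def stickPoint (q : H2 × ℝ) (s : ℝ) : H2 :=
  translation q.1 (polar s (q.2 + Complex.arg (q.1 : ℂ)))

lemma originStick_eq (L φ : ℝ) :
    originStick L φ = (fun r => polar r φ) '' Set.Icc (-(L / 2)) (L / 2) := by
  have hneg : ∀ r, polar r (φ + Real.pi) = polar (-r) φ := fun r => by
    apply Complex.UnitDisc.coe_injective
    rw [coe_polar, coe_polar]
    push_cast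
    rw [add_mul, Complex.exp_add, Complex.exp_pi_mul_I, neg_div, Complex.tanh_neg]
    ring
  ext z
  simp only [originStick, hneg, Set.mem_union, Set.mem_image, Set.mem_Icc]
  constructor
  · rintro (⟨r, ⟨h0, h1⟩, rfl⟩ | ⟨r, ⟨h0, h1⟩, rfl⟩)
    · exact ⟨r, ⟨by linarith, h1⟩, rfl⟩
    · exact ⟨-r, ⟨by linarith, by linarith⟩, rfl⟩
  · rintro ⟨r, ⟨h0, h1⟩, rfl⟩
    rcases le_total 0 r with h | h
    · exact Or.inl ⟨r, ⟨h, h1⟩, rfl⟩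
    · exact Or.inr ⟨-r, ⟨by linarith, by linarith⟩, by rw [neg_neg]⟩

lemma stick_eq (L : ℝ) (q : H2 × ℝ) :
    stick L q.1 q.2 = stickPoint q '' Set.Icc (-(L / 2)) (L / 2) := by
  rw [stick, originStick_eq, Set.image_image]
  rfl

lemma norm_polar (s t : ℝ) : ‖(polar s t : ℂ)‖ = |Real.tanh (s / 2)| := by
  rw [coe_polar, norm_mul, Complex.norm_exp_ofReal_mul_I, mul_one, Complex.norm_real,
    Real.norm_eq_abs]

lemma norm_polar_le {L s t : ℝ} (hs : s ∈ Set.Icc (-(L / 2)) (L / 2)) :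
    ‖(polar s t : ℂ)‖ ≤ Real.tanh (L / 4) := by
  rw [norm_polar, abs_le, ← Real.tanh_neg, tanh_le_tanh_iff, tanh_le_tanh_iff]
  exact ⟨by linarith [hs.1], by linarith [hs.2]⟩

/-- The velocity of `stickPoint q` at `s`, as a vector of the Euclidean plane. -/
noncomputable def stickVelocity (q : H2 × ℝ) (s : ℝ) : ℂ :=
  (1 - ‖(q.1 : ℂ)‖ ^ 2 : ℝ) / (1 + conj (q.1 : ℂ) * polar s (q.2 + Complex.arg (q.1 : ℂ))) ^ 2
    * (((1 - Real.tanh (s / 2) ^ 2) / 2 : ℝ)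
      * Complex.exp ((q.2 + Complex.arg (q.1 : ℂ) : ℝ) * Complex.I))

lemma hasDerivAt_stickPoint (q : H2 × ℝ) (s : ℝ) :
    HasDerivAt (fun s => (stickPoint q s : ℂ)) (stickVelocity q s) s := by
  have h1 : HasDerivAt (fun s => (polar s (q.2 + Complex.arg (q.1 : ℂ)) : ℂ))
      (((1 - Real.tanh (s / 2) ^ 2) / 2 : ℝ)
        * Complex.exp ((q.2 + Complex.arg (q.1 : ℂ) : ℝ) * Complex.I)) s :=
    (hasDerivAt_tanh_half s).ofReal_comp.mul_const _
  exact (hasDerivAt_translation q.1 _).comp s h1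

lemma norm_stickVelocity (q : H2 × ℝ) (s : ℝ) :
    ‖stickVelocity q s‖ = (1 - ‖(stickPoint q s : ℂ)‖ ^ 2) / 2 := by
  have h1 := one_sub_tanh_sq_pos (s / 2)
  have h2 : 0 < 1 - ‖(q.1 : ℂ)‖ ^ 2 := by linarith [q.1.sq_norm_lt_one]
  rw [stickPoint, one_sub_norm_sq_translation, norm_polar, sq_abs, stickVelocity, norm_mul,
    norm_div, norm_mul, Complex.norm_exp_ofReal_mul_I, norm_pow, Complex.norm_real,
    Complex.norm_real,
    Real.norm_of_nonneg h2.le, Real.norm_of_nonneg (by positivity)]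
  ring

lemma continuous_polar : Continuous fun p : ℝ × ℝ => polar p.1 p.2 := by
  rw [Complex.UnitDisc.isEmbedding_coe.continuous_iff]
  have h : Continuous fun r : ℝ => Real.tanh (r / 2) :=
    continuous_iff_continuousAt.2 fun r => (hasDerivAt_tanh_half r).continuousAt
  have h2 : Continuous fun p : ℝ × ℝ => Real.tanh (p.1 / 2) := h.comp continuous_fst
  exact (Complex.continuous_ofReal.comp h2).mul (by fun_prop)

lemma continuous_stickPoint (q : H2 × ℝ) : Continuous (stickPoint q) :=
  continuous_translation.comp (continuous_const.prodMk
    (continuous_polar.comp (continuous_id.prodMk continuous_const)))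

lemma measurable_stickVelocity (q : H2 × ℝ) : Measurable (stickVelocity q) := by
  have : stickVelocity q = deriv fun s => (stickPoint q s : ℂ) :=
    funext fun s => (hasDerivAt_stickPoint q s).deriv.symm
  rw [this]
  exact measurable_deriv _

lemma isCompact_stick (L : ℝ) (q : H2 × ℝ) : IsCompact (stick L q.1 q.2) := by
  rw [stick_eq]
  exact isCompact_Icc.image (continuous_stickPoint q)

/-- Sticks are null sets, being images under translations of subsets of Euclidean lines. -/
lemma hypArea_stick (L : ℝ) (q : H2 × ℝ) : hypArea (stick L q.1 q.2) = 0 := by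
  set e : ℂ := Complex.exp ((q.2 + Complex.arg (q.1 : ℂ) : ℝ) * Complex.I)
  set ℓ : Submodule ℝ ℂ := ℝ ∙ e
  have hℓ : MeasurableSet (ℓ : Set ℂ) := ℓ.closed_of_finiteDimensional.measurableSet
  have hℓ0 : volume (ℓ : Set ℂ) = 0 := by
    refine Measure.addHaar_submodule _ _ fun h => ?_
    have h1 := finrank_span_le_card (R := ℝ) ({e} : Set ℂ)
    have h2 : Module.finrank ℝ ℓ = 2 := by rw [h, finrank_top, Complex.finrank_real_complex]
    rw [Set.toFinset_singleton, Finset.card_singleton] at h1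
    change Module.finrank ℝ ℓ ≤ 1 at h1
    omega
  have hT : Measurable (translation (-q.1)) :=
    (continuous_translation.comp (Continuous.prodMk_right _)).measurable
  have hA : MeasurableSet ((fun x : H2 => (x : ℂ)) ⁻¹' ℓ) := measurable_coe hℓ
  have hnull : hypArea ((fun x : H2 => (x : ℂ)) ⁻¹' ℓ) = 0 := by
    rw [← lintegral_indicator_one hA]
    have h := lintegral_hypArea (measurable_one.indicator hℓ : Measurable
      ((ℓ : Set ℂ).indicator (1 : ℂ → ℝ≥0∞)))
    refine h.trans (lintegral_eq_zero_of_ae_eq_zero (ae_restrict_of_ae ?_))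
    filter_upwards [measure_eq_zero_iff_ae_notMem.1 hℓ0] with z hz
    simp [Set.indicator_of_notMem hz]
  refine measure_mono_null ?_ ((Measure.map_apply hT hA).symm.trans
    ((congrArg (fun μ : Measure H2 => μ _) (map_translation_hypArea _)).trans hnull))
  rw [stick_eq]
  rintro _ ⟨s, -, rfl⟩
  simp only [stickPoint, Set.mem_preimage, translation_neg_translation]
  exact Submodule.mem_span_singleton.2 ⟨Real.tanh (s / 2), by rw [coe_polar]; simp [e]⟩

/-! ### The kinematic formula for sticks -/

/-- For a point moving through `z` with velocity `v`, the rate at which its direction turns when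
observed from `x` in the hyperbolic plane. -/
noncomputable def turningRate (z v x : ℂ) : ℝ :=
  |(v * (1 - ‖x‖ ^ 2 : ℝ) / ((1 - conj x * z) * (z - x))).im|

/-- The turning rate, set to be `0` unless the observer `x` is near to `z`: the Euclidean distance
from the origin, after a translation that maps `x` to the origin, has to be at most `c`. -/
noncomputable def nearTurningRate (c : ℝ) (z v x : ℂ) : ℝ≥0∞ :=
  {x : ℂ | ‖(z - x) / (1 - conj x * z)‖ ≤ c}.indicator
    (fun x => ENNReal.ofReal (turningRate z v x)) x

lemma coe_translation_neg (x z : H2) :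
    (translation (-x) z : ℂ) = ((z : ℂ) - x) / (1 - conj (x : ℂ) * z) := by
  rw [coe_translation]
  simp [sub_eq_add_neg]

lemma sub_translation (z u : H2) : (z : ℂ) - translation z u
    = -u * (1 - ‖(z : ℂ)‖ ^ 2 : ℝ) / (1 + conj (z : ℂ) * u) := by
  have h1 := one_add_conj_mul_ne_zero z u
  have h2 : ((‖(z : ℂ)‖ ^ 2 : ℝ) : ℂ) = conj (z : ℂ) * z := by
    rw [← Complex.normSq_eq_norm_sq, Complex.normSq_eq_conj_mul_self]
  have h3 : (translation z u : ℂ) * (1 + conj (z : ℂ) * u) = u + z := div_mul_cancel₀ _ h1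
  rw [eq_div_iff h1, Complex.ofReal_sub, h2, Complex.ofReal_one]
  linear_combination -h3

lemma one_sub_conj_translation_mul (z u : H2) : 1 - conj (translation z u : ℂ) * z
    = (1 - ‖(z : ℂ)‖ ^ 2 : ℝ) / conj (1 + conj (z : ℂ) * u) := by
  have h1 := one_add_conj_mul_ne_zero z u
  have h1' : conj (1 + conj (z : ℂ) * u) ≠ 0 := (map_ne_zero _).2 h1
  have h2 : ((‖(z : ℂ)‖ ^ 2 : ℝ) : ℂ) = conj (z : ℂ) * z := by
    rw [← Complex.normSq_eq_norm_sq, Complex.normSq_eq_conj_mul_self]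
  have h3 : (translation z u : ℂ) * (1 + conj (z : ℂ) * u) = u + z := div_mul_cancel₀ _ h1
  have h4 := congrArg conj h3
  rw [map_mul] at h4
  rw [eq_div_iff h1', Complex.ofReal_sub, h2, Complex.ofReal_one]
  simp only [map_add, map_mul, map_one, Complex.conj_conj] at h4 ⊢
  linear_combination -(z : ℂ) * h4

lemma norm_sub_div_translation (z u : H2) :
    ‖((z : ℂ) - translation z u) / (1 - conj (translation z u : ℂ) * z)‖ = ‖(u : ℂ)‖ := by
  have hD : ‖1 + conj (z : ℂ) * u‖ ≠ 0 := norm_ne_zero_iff.2 (one_add_conj_mul_ne_zero z u)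
  have hz : ‖((1 - ‖(z : ℂ)‖ ^ 2 : ℝ) : ℂ)‖ ≠ 0 := by
    rw [norm_ne_zero_iff, Complex.ofReal_ne_zero]
    linarith [z.sq_norm_lt_one]
  rw [sub_translation, one_sub_conj_translation_mul, norm_div, norm_div, norm_div, RCLike.norm_conj,
    norm_mul, norm_neg]
  field_simp

lemma turningRate_translation (z u : H2) (v : ℂ) :
    turningRate z v (translation z u)
      = |(v / (1 - ‖(z : ℂ)‖ ^ 2 : ℝ) / u).im| * (1 - ‖(u : ℂ)‖ ^ 2) := by
  have hD := one_add_conj_mul_ne_zero z u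
  have hz : ((1 - ‖(z : ℂ)‖ ^ 2 : ℝ) : ℂ) ≠ 0 := by
    rw [Complex.ofReal_ne_zero]
    linarith [z.sq_norm_lt_one]
  have hu : 0 < 1 - ‖(u : ℂ)‖ ^ 2 := by linarith [u.sq_norm_lt_one]
  have hD' : conj (1 + conj (z : ℂ) * u) ≠ 0 := (map_ne_zero _).2 hD
  rw [turningRate, one_sub_norm_sq_translation, sub_translation, one_sub_conj_translation_mul,
    Complex.ofReal_div, Complex.ofReal_mul, ← Complex.normSq_eq_norm_sq (1 + _),
    ← Complex.mul_conj]
  generalize 1 + conj (z : ℂ) * u = D at *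
  generalize conj D = D' at *
  generalize ((1 - ‖(z : ℂ)‖ ^ 2 : ℝ) : ℂ) = N at *
  have key : v * (N * ((1 - ‖(u : ℂ)‖ ^ 2 : ℝ) : ℂ) / (D * D')) / (N / D' * (-u * N / D))
      = ((-(1 - ‖(u : ℂ)‖ ^ 2) : ℝ) : ℂ) * (v / N / u) := by
    rw [Complex.ofReal_neg]
    -- For `u = 0` both sides vanish, as divisions by zero.
    rcases eq_or_ne (u : ℂ) 0 with h | h
    · simp [h]
    · field_simp
  rw [key, Complex.im_ofReal_mul, abs_mul, abs_neg, abs_of_pos hu, mul_comm]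

lemma lintegral_abs_sin_sub (α : ℝ) :
    ∫⁻ t in Set.Ico 0 (2 * Real.pi), ENNReal.ofReal |Real.sin (α - t)| = 4 := by
  have hper : Function.Periodic (fun t => |Real.sin t|) Real.pi := fun t => by
    simp [Real.sin_add_pi]
  have hc : Continuous fun t => |Real.sin t| := by fun_prop
  have hbase : ∫ t in (0 : ℝ)..Real.pi, |Real.sin t| = 2 := by
    have : ∫ t in (0 : ℝ)..Real.pi, |Real.sin t| = ∫ t in (0 : ℝ)..Real.pi, Real.sin t := by
      refine intervalIntegral.integral_congr fun t ht => ?_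
      rw [Set.uIcc_of_le Real.pi_pos.le] at ht
      exact abs_of_nonneg (Real.sin_nonneg_of_mem_Icc ht)
    rw [this, integral_sin]
    norm_num
  have hint : ∫ t in (0 : ℝ)..(2 * Real.pi), |Real.sin (α - t)| = 4 := by
    rw [intervalIntegral.integral_comp_sub_left (fun t => |Real.sin t|) α]
    have h1 := hper.intervalIntegral_add_eq (α - 2 * Real.pi) 0
    have h2 := hper.intervalIntegral_add_eq (α - Real.pi) 0
    rw [zero_add, hbase] at h1 h2
    rw [show α - 2 * Real.pi + Real.pi = α - Real.pi by ring] at h1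
    rw [show α - Real.pi + Real.pi = α - 0 by ring] at h2
    rw [← intervalIntegral.integral_add_adjacent_intervals (hc.intervalIntegrable _ _)
      (hc.intervalIntegrable _ _), h1, h2]
    norm_num
  have hc' : Continuous fun t => |Real.sin (α - t)| := by fun_prop
  rw [setLIntegral_congr Ico_ae_eq_Ioc, ← ofReal_integral_eq_lintegral_ofReal
    ((intervalIntegrable_iff_integrableOn_Ioc_of_le Real.two_pi_pos.le).1
      (hc'.intervalIntegrable _ _)) (ae_of_all _ fun t => abs_nonneg _),
    ← intervalIntegral.integral_of_le Real.two_pi_pos.le, hint]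
  norm_num

lemma measurable_nearTurningRate {Ω : Type*} [MeasurableSpace Ω] (c : ℝ) {f g h : Ω → ℂ}
    (hf : Measurable f) (hg : Measurable g) (hh : Measurable h) :
    Measurable fun a => nearTurningRate c (f a) (g a) (h a) := by
  have h1 : MeasurableSet {a | ‖(f a - h a) / (1 - conj (h a) * f a)‖ ≤ c} :=
    measurableSet_le (by fun_prop) measurable_const
  have h2 : Measurable fun a => ENNReal.ofReal (turningRate (f a) (g a) (h a)) := by
    unfold turningRate
    have : Measurable fun a =>
      (g a * (1 - ‖h a‖ ^ 2 : ℝ) / ((1 - conj (h a) * f a) * (f a - h a))) := by fun_prop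
    exact (Complex.measurable_im.comp this).abs.ennreal_ofReal
  exact h2.indicator h1

/-- The integral over all observers of the turning rate of a point at the origin that moves with
unit hyperbolic speed in the direction `α`, computed in polar coordinates. -/
lemma lintegral_turningRate_origin (L α : ℝ) :
    ∫⁻ u : H2, {u : ℂ | ‖u‖ ≤ Real.tanh (L / 4)}.indicator (fun u => ENNReal.ofReal
      (|(1 / 2 * Complex.exp (α * Complex.I) / u).im| * (1 - ‖u‖ ^ 2))) u ∂hypArea
        ≤ ENNReal.ofReal (2 * L) := by
  set c := Real.tanh (L / 4)
  set g : ℂ → ℝ≥0∞ := {u : ℂ | ‖u‖ ≤ c}.indicator fun u => ENNReal.ofReal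
    (|(1 / 2 * Complex.exp (α * Complex.I) / u).im| * (1 - ‖u‖ ^ 2)) with hg
  have hgm : Measurable g := by
    have h1 : Measurable fun u : ℂ => 1 / 2 * Complex.exp (α * Complex.I) / u := by fun_prop
    exact ((((Complex.measurable_im.comp h1).abs).mul (by fun_prop)).ennreal_ofReal).indicator
      (measurableSet_le measurable_norm measurable_const)
  rw [lintegral_hypArea_polar hgm]
  calc _ ≤ ∫⁻ r in Set.Ioi 0, (Set.Iic (L / 2)).indicator (fun _ => (4 : ℝ≥0∞)) r := by
        refine setLIntegral_mono' measurableSet_Ioi fun r hr => ?_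
        have hr' : (0 : ℝ) < r := hr
        have hth : 0 < Real.tanh (r / 2) := by
          have : Real.tanh (r / 2) ∈ Set.Ioo (0 : ℝ) 1 := by
            rw [← tanh_half_image_Ioi]; exact ⟨r, hr, rfl⟩
          exact this.1
        have hn : ∀ t : ℝ, ‖(Real.tanh (r / 2) : ℂ) * Complex.exp (t * Complex.I)‖
            = Real.tanh (r / 2) := fun t => by
          rw [norm_mul, Complex.norm_exp_ofReal_mul_I, mul_one, Complex.norm_real,
            Real.norm_of_nonneg hth.le]
        have hle : Real.tanh (r / 2) ≤ c ↔ r ≤ L / 2 := by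
          rw [tanh_le_tanh_iff]
          constructor <;> intro h <;> linarith
        by_cases hrL : r ≤ L / 2
        · rw [Set.indicator_of_mem (show r ∈ Set.Iic (L / 2) from hrL), ← lintegral_abs_sin_sub α]
          refine le_of_eq (lintegral_congr fun t => ?_)
          have hmem : (Real.tanh (r / 2) : ℂ) * Complex.exp (t * Complex.I)
              ∈ {u : ℂ | ‖u‖ ≤ c} := by
            rw [Set.mem_ofPred_eq, hn]; exact hle.2 hrL
          rw [hg, Set.indicator_of_mem hmem, hn,
            ← ENNReal.ofReal_mul (Real.sinh_nonneg_iff.2 hr'.le)]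
          congr 1
          have h3 : 1 / 2 * Complex.exp (α * Complex.I)
              / ((Real.tanh (r / 2) : ℂ) * Complex.exp (t * Complex.I))
              = (1 / (2 * Real.tanh (r / 2)) : ℝ) * Complex.exp ((α - t : ℝ) * Complex.I) := by
            rw [Complex.ofReal_sub, sub_mul, Complex.exp_sub]
            push_cast
            ring
          rw [h3, Complex.im_ofReal_mul, Complex.exp_ofReal_mul_I_im, abs_mul,
            abs_of_pos (by positivity)]
          have h4 := sinh_mul_one_sub_tanh_half_sq r
          field_simp
          linear_combination |Real.sin (α - t)| * h4
        · have : ∀ t : ℝ, g ((Real.tanh (r / 2) : ℂ) * Complex.exp (t * Complex.I)) = 0 := by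
            intro t
            refine Set.indicator_of_notMem ?_ _
            rw [Set.mem_ofPred_eq, hn]
            exact fun h => hrL (hle.1 h)
          simp only [this, mul_zero, lintegral_zero, zero_le]
    _ = 4 * ENNReal.ofReal (L / 2) := by
        rw [setLIntegral_indicator measurableSet_Iic, setLIntegral_const, Set.inter_comm,
          Set.Ioi_inter_Iic, Real.volume_Ioc, sub_zero]
    _ = ENNReal.ofReal (2 * L) := by
        rw [← ENNReal.ofReal_ofNat 4, ← ENNReal.ofReal_mul (by norm_num)]
        congr 1
        ring

/-- The turning rate of a point that moves with unit hyperbolic speed, integrated over all observers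
at hyperbolic distance at most `L / 2`. By the invariance of the hyperbolic area, the position of
the point does not matter. -/
lemma lintegral_nearTurningRate_le (L : ℝ) (z : H2) {v : ℂ}
    (hv : ‖v‖ = (1 - ‖(z : ℂ)‖ ^ 2) / 2) :
    ∫⁻ x : H2, nearTurningRate (Real.tanh (L / 4)) z v x ∂hypArea ≤ ENNReal.ofReal (2 * L) := by
  have hz : 0 < 1 - ‖(z : ℂ)‖ ^ 2 := by linarith [z.sq_norm_lt_one]
  set c := Real.tanh (L / 4)
  have hT : Measurable (translation z) :=
    (continuous_translation.comp (Continuous.prodMk_right z)).measurable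
  have hm : Measurable fun x : H2 => nearTurningRate c z v x :=
    measurable_nearTurningRate c measurable_const measurable_const measurable_coe
  obtain ⟨α, hα⟩ : ∃ α : ℝ,
      v / (1 - ‖(z : ℂ)‖ ^ 2 : ℝ) = (1 / 2) * Complex.exp (α * Complex.I) := by
    refine ⟨Complex.arg v, ?_⟩
    have hz' : ((1 - ‖(z : ℂ)‖ ^ 2 : ℝ) : ℂ) ≠ 0 := Complex.ofReal_ne_zero.2 hz.ne'
    rw [div_eq_iff hz']
    conv_lhs => rw [← Complex.norm_mul_exp_arg_mul_I v, hv]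
    push_cast
    ring
  have h1 : ∀ u : H2, nearTurningRate c z v (translation z u)
      = {u : ℂ | ‖u‖ ≤ c}.indicator (fun u => ENNReal.ofReal
        (|(1 / 2 * Complex.exp (α * Complex.I) / u).im| * (1 - ‖u‖ ^ 2))) u := fun u => by
    simp only [nearTurningRate, Set.indicator, Set.mem_ofPred_eq, norm_sub_div_translation,
      turningRate_translation, hα]
  conv_lhs => rw [← map_translation_hypArea z]
  rw [lintegral_map hm hT]
  simp only [h1]
  exact lintegral_turningRate_origin L α

/-- The kinematic formula (as an upper bound): in the mean over the centres, the directions of the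
sticks that hit a given stick form a set of length at most `2 L²`. -/
theorem lintegral_volume_hits_le {L : ℝ} (hL : 0 ≤ L) (q : H2 × ℝ) :
    ∫⁻ x : H2, volume {φ | φ ∈ Set.Ico 0 Real.pi ∧
        (stick L x φ ∩ stick L q.1 q.2).Nonempty} ∂hypArea ≤ ENNReal.ofReal (2 * L ^ 2) := by
  set c := Real.tanh (L / 4) with hc
  set I := Set.Icc (-(L / 2)) (L / 2)
  have hx : ∀ x : H2, x ∉ stick L q.1 q.2 → volume {φ | φ ∈ Set.Ico 0 Real.pi ∧
      (stick L x φ ∩ stick L q.1 q.2).Nonempty}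
        ≤ ∫⁻ s in I, nearTurningRate c (stickPoint q s) (stickVelocity q s) x := fun x hx => by
    set w : ℝ → ℂ := fun s => translation (-x) (stickPoint q s) with hw
    have hwd : ∀ s, HasDerivAt w ((1 - ‖(x : ℂ)‖ ^ 2 : ℝ)
        / (1 - conj (x : ℂ) * stickPoint q s) ^ 2 * stickVelocity q s) s := fun s => by
      have := (hasDerivAt_translation (-x) (stickPoint q s)).comp s (hasDerivAt_stickPoint q s)
      refine this.congr_deriv ?_
      simp [sub_eq_add_neg]
    have hwc : Continuous w := continuous_iff_continuousAt.2 fun s => (hwd s).continuousAt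
    have hB : MeasurableSet {s | ‖w s‖ ≤ c} :=
      measurableSet_le hwc.norm.measurable measurable_const
    set S := {s | ‖w s‖ ≤ c} ∩ I
    have hS : MeasurableSet S := hB.inter measurableSet_Icc
    have h0 : ∀ s ∈ S, w s ≠ 0 := fun s hs h => hx (by
      have h1 : translation (-x) (stickPoint q s) = 0 := Complex.UnitDisc.coe_injective h
      have h2 := translation_translation_neg x (stickPoint q s)
      rw [h1] at h2
      have h3 : translation x 0 = x := Complex.UnitDisc.coe_injective (by simp [coe_translation])
      rw [h3] at h2
      rw [stick_eq, h2]
      exact ⟨s, hs.2, rfl⟩)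
    have hdir := volume_directions_le hwd hS h0 (Complex.arg (x : ℂ))
    refine (measure_mono ?_).trans (hdir.trans ?_)
    · rintro φ ⟨hφ, y, hy1, hy2⟩
      rw [stick_eq] at hy2
      rw [show stick L x φ = stick L (x, φ).1 (x, φ).2 from rfl, stick_eq] at hy1
      obtain ⟨t, ht, rfl⟩ := hy1
      obtain ⟨s, hs, hst⟩ := hy2
      have hws : w s = polar t (φ + Complex.arg (x : ℂ)) := by
        change (translation (-x) (stickPoint q s) : ℂ) = _
        rw [hst, stickPoint, translation_neg_translation]
      refine ⟨hφ, s, ⟨?_, hs⟩, Real.tanh (t / 2), by rw [hws, coe_polar]⟩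
      rw [Set.mem_ofPred_eq, hws]
      exact norm_polar_le ht
    · rw [← setLIntegral_indicator hB]
      refine le_of_eq (lintegral_congr fun s => ?_)
      have hws : w s = ((stickPoint q s : ℂ) - x) / (1 - conj (x : ℂ) * stickPoint q s) :=
        coe_translation_neg x _
      simp only [nearTurningRate, turningRate, Set.indicator, Set.mem_ofPred_eq, hws]
      split_ifs
      · -- The derivative of `w` divided by `w`; divisions by zero give `0` on both sides.
        congr 3
        rcases eq_or_ne (1 - conj (x : ℂ) * stickPoint q s) 0 with h | h
        · simp [h]
        rcases eq_or_ne ((stickPoint q s : ℂ) - x) 0 with h' | h'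
        · simp [h']
        field_simp
      · rfl
  calc _ ≤ ∫⁻ x : H2, (∫⁻ s in I, nearTurningRate c (stickPoint q s) (stickVelocity q s) x)
        ∂hypArea := by
        refine lintegral_mono_ae ?_
        filter_upwards [measure_eq_zero_iff_ae_notMem.1 (hypArea_stick L q)] with x h
        exact hx x h
    _ = ∫⁻ s in I, ∫⁻ x : H2, nearTurningRate c (stickPoint q s) (stickVelocity q s) x
        ∂hypArea := by
        refine lintegral_lintegral_swap (Measurable.aemeasurable ?_)
        exact measurable_nearTurningRate c
          ((measurable_coe.comp (continuous_stickPoint q).measurable).comp measurable_snd)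
          ((measurable_stickVelocity q).comp measurable_snd) (measurable_coe.comp measurable_fst)
    _ ≤ ∫⁻ _ in I, ENNReal.ofReal (2 * L) :=
        lintegral_mono fun s => lintegral_nearTurningRate_le L _ (norm_stickVelocity q s)
    _ = ENNReal.ofReal (2 * L ^ 2) := by
        rw [setLIntegral_const, Real.volume_Icc, ← ENNReal.ofReal_mul (by positivity)]
        congr 1
        ring

/-! ### The relation of intersecting sticks -/

instance : SecondCountableTopology H2 :=
  Complex.UnitDisc.isEmbedding_coe.secondCountableTopology

instance : T2Space H2 := Complex.UnitDisc.isEmbedding_coe.t2Space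

/-- The sticks `p` and `q` (given by centre and angle) intersect. -/
def Hits (L : ℝ) (p q : H2 × ℝ) : Prop := (stick L p.1 p.2 ∩ stick L q.1 q.2).Nonempty

lemma Hits.symm {L : ℝ} {p q : H2 × ℝ} (h : Hits L p q) : Hits L q p := by
  rwa [Hits, Set.inter_comm]

lemma measurableSet_preimage_prodMap {α β : Type*} [MeasurableSpace α] [MeasurableSpace β]
    {f : α → β} (hf : Measurable f) {A : Set (β × β)} (hA : MeasurableSet A) :
    MeasurableSet {p : α × α | (f p.1, f p.2) ∈ A} :=
  ((hf.comp measurable_fst).prodMk (hf.comp measurable_snd)) hA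

lemma measurableSet_hits (L : ℝ) :
    MeasurableSet {p : (H2 × ℝ) × (H2 × ℝ) | Hits L p.1 p.2} := by
  -- In terms of the angles to the horizontal axis, the relation is closed, as a projection of a
  -- closed set along a compact factor.
  set J := Set.Icc (-(L / 2)) (L / 2)
  set γ : H2 × ℝ → ℝ → H2 := fun p s => translation p.1 (polar s p.2) with hγ
  have hγc : Continuous fun q : (H2 × ℝ) × ℝ => γ q.1 q.2 :=
    continuous_translation.comp ((continuous_fst.comp continuous_fst).prodMk
      (continuous_polar.comp (continuous_snd.prodMk (continuous_snd.comp continuous_fst))))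
  set C : Set (((H2 × ℝ) × (H2 × ℝ)) × (J × J)) := {q | γ q.1.1 q.2.1 = γ q.1.2 q.2.2}
  have hC : IsClosed C := by
    refine isClosed_eq ?_ ?_
    · exact hγc.comp (g := fun q : (H2 × ℝ) × ℝ => γ q.1 q.2)
        (f := fun q : ((H2 × ℝ) × (H2 × ℝ)) × (J × J) => (q.1.1, (q.2.1 : ℝ))) (by fun_prop)
    · exact hγc.comp (g := fun q : (H2 × ℝ) × ℝ => γ q.1 q.2)
        (f := fun q : ((H2 × ℝ) × (H2 × ℝ)) × (J × J) => (q.1.2, (q.2.2 : ℝ))) (by fun_prop)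
  have hP : IsClosed (Prod.fst '' C) := isClosedMap_fst_of_compactSpace C hC
  have harg : Measurable fun p : H2 × ℝ => (p.1, p.2 + Complex.arg (p.1 : ℂ)) :=
    measurable_fst.prodMk (measurable_snd.add
      (Complex.measurable_arg.comp (measurable_coe.comp measurable_fst)))
  have hP' : MeasurableSet (Prod.fst '' C) := hP.measurableSet
  have hA := measurableSet_preimage_prodMap harg hP'
  have heq : ∀ p q : H2 × ℝ, Hits L p q ↔
      ((p.1, p.2 + Complex.arg (p.1 : ℂ)), (q.1, q.2 + Complex.arg (q.1 : ℂ))) ∈ Prod.fst '' C := by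
    intro p q
    rw [Hits, stick_eq, stick_eq]
    constructor
    · rintro ⟨_, ⟨s, hs, rfl⟩, ⟨t, ht, hst⟩⟩
      have hmem : (((p.1, p.2 + Complex.arg (p.1 : ℂ)), (q.1, q.2 + Complex.arg (q.1 : ℂ))),
          ((⟨s, hs⟩ : J), (⟨t, ht⟩ : J))) ∈ C := hst.symm
      exact ⟨_, hmem, rfl⟩
    · rintro ⟨⟨pq, ⟨s, hs⟩, ⟨t, ht⟩⟩, hst, rfl⟩
      exact ⟨_, ⟨s, hs, rfl⟩, ⟨t, ht, Eq.symm hst⟩⟩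
  have hset : {p : (H2 × ℝ) × (H2 × ℝ) | Hits L p.1 p.2} = _ := Set.ext fun p => heq p.1 p.2
  rw [hset]
  exact hA

/-- The measure of the set of sticks that hit a given stick. -/
lemma stickMeasure_hits_le {L : ℝ} (hL : 0 ≤ L) (q : H2 × ℝ) :
    stickMeasure {p | Hits L q p} ≤ (ENNReal.ofReal Real.pi)⁻¹ * ENNReal.ofReal (2 * L ^ 2) := by
  have hm : MeasurableSet {p | Hits L q p} :=
    measurableSet_related (r := Hits L) (measurableSet_hits L) q
  rw [stickMeasure, Measure.prod_apply hm]
  refine le_trans ?_ (mul_le_mul_right (lintegral_volume_hits_le hL q) _)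
  rw [← lintegral_const_mul' _ _ (by simp [Real.pi_pos])]
  refine lintegral_mono fun x => ?_
  have hmx : MeasurableSet (Prod.mk x ⁻¹' {p | Hits L q p}) := measurable_prodMk_left hm
  rw [angleMeasure, Measure.smul_apply, smul_eq_mul, Measure.restrict_apply hmx]
  refine mul_le_mul_right (measure_mono ?_) _
  rintro φ ⟨h1, h2⟩
  have h1' : Hits L q (x, φ) := h1
  exact ⟨h2, h1'.symm⟩

/-! ### Sticks stay at a bounded distance from their centres -/

/-- The Euclidean quantity `1 - |z|²`, which tends to `0` when `z` tends to infinity in the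
hyperbolic plane. It replaces the hyperbolic distance from the origin. -/
noncomputable def depth (z : H2) : ℝ := 1 - ‖(z : ℂ)‖ ^ 2

lemma depth_pos (z : H2) : 0 < depth z := by
  have := z.sq_norm_lt_one
  unfold depth
  linarith

lemma continuous_depth : Continuous depth := by
  have := Complex.UnitDisc.continuous_coe
  unfold depth
  fun_prop

/-- The depths of the points of a stick are comparable to the depth of its centre. -/
lemma exists_depth_ratio {L : ℝ} (hL : 0 ≤ L) : ∃ κ : ℝ, 0 < κ ∧ κ ≤ 1 ∧
    ∀ (q : H2 × ℝ), ∀ y ∈ stick L q.1 q.2, κ * depth q.1 ≤ depth y ∧ κ * depth y ≤ depth q.1 := by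
  set c := Real.tanh (L / 4) with hc
  have hc1 : c < 1 := Real.tanh_lt_one _
  have hc0 : 0 ≤ c := by
    rw [← Real.tanh_zero, hc, tanh_le_tanh_iff]
    positivity
  refine ⟨(1 - c) ^ 2 / 4, by have := sub_pos.2 hc1; positivity, by nlinarith, fun q y hy => ?_⟩
  rw [stick_eq] at hy
  obtain ⟨s, hs, rfl⟩ := hy
  set u := polar s (q.2 + Complex.arg (q.1 : ℂ)) with hu
  have hn : ‖(u : ℂ)‖ ≤ c := norm_polar_le hs
  have hd : depth (stickPoint q s) = depth q.1 * depth u / ‖1 + conj (q.1 : ℂ) * u‖ ^ 2 :=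
    one_sub_norm_sq_translation q.1 u
  have hx := q.1.norm_lt_one
  have hxu : ‖conj (q.1 : ℂ) * u‖ ≤ c := by
    rw [norm_mul, RCLike.norm_conj]
    exact (mul_le_of_le_one_left (norm_nonneg _) hx.le).trans hn
  have hlow : 1 - c ≤ ‖1 + conj (q.1 : ℂ) * u‖ := by
    have := norm_sub_norm_le (1 : ℂ) (-(conj (q.1 : ℂ) * u))
    rw [norm_neg, sub_neg_eq_add, norm_one] at this
    linarith
  have hup : ‖1 + conj (q.1 : ℂ) * u‖ ≤ 2 := by
    have := norm_add_le (1 : ℂ) (conj (q.1 : ℂ) * u)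
    rw [norm_one] at this
    linarith
  have hpos : 0 < ‖1 + conj (q.1 : ℂ) * u‖ := by linarith
  have hdu : 1 - c ^ 2 ≤ depth u := by
    have : ‖(u : ℂ)‖ ^ 2 ≤ c ^ 2 := by gcongr
    unfold depth
    linarith
  have hdu1 : depth u ≤ 1 := by
    have := sq_nonneg ‖(u : ℂ)‖
    unfold depth
    linarith
  have hD := depth_pos q.1
  have hsq : ‖1 + conj (q.1 : ℂ) * u‖ ^ 2 ≤ 4 := by nlinarith
  have hsq' : (1 - c) ^ 2 ≤ ‖1 + conj (q.1 : ℂ) * u‖ ^ 2 := by nlinarith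
  rw [hd]
  constructor
  · rw [le_div_iff₀ (by positivity)]
    have h1 : (1 - c) ^ 2 ≤ depth u := by nlinarith
    calc (1 - c) ^ 2 / 4 * depth q.1 * ‖1 + conj (q.1 : ℂ) * u‖ ^ 2
        ≤ (1 - c) ^ 2 / 4 * depth q.1 * 4 := by gcongr
      _ = depth q.1 * (1 - c) ^ 2 := by ring
      _ ≤ depth q.1 * depth u := by gcongr
  · rw [← mul_div_assoc, div_le_iff₀ (by positivity)]
    calc (1 - c) ^ 2 / 4 * (depth q.1 * depth u) ≤ (1 - c) ^ 2 * (depth q.1 * 1) := by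
          have : 0 ≤ (1 - c) ^ 2 := sq_nonneg _
          have := mul_nonneg this (mul_nonneg hD.le (depth_pos u).le)
          have : (1 - c) ^ 2 * (depth q.1 * depth u) ≤ (1 - c) ^ 2 * (depth q.1 * 1) := by gcongr
          linarith
      _ ≤ _ := by
          rw [mul_one, mul_comm]
          gcongr

lemma stickMeasure_depth_ne_top {δ : ℝ} (hδ : 0 < δ) :
    stickMeasure {p | δ ≤ depth p.1} ≠ ∞ := by
  have hA : MeasurableSet {x : H2 | δ ≤ depth x} :=
    measurableSet_le measurable_const continuous_depth.measurable
  have hB : MeasurableSet {z : ℂ | δ ≤ 1 - ‖z‖ ^ 2} :=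
    measurableSet_le measurable_const (by fun_prop)
  have h1 : hypArea {x : H2 | δ ≤ depth x} ≠ ∞ := by
    rw [← lintegral_indicator_one hA]
    have h := lintegral_hypArea (measurable_one.indicator hB : Measurable
      ({z : ℂ | δ ≤ 1 - ‖z‖ ^ 2}.indicator (1 : ℂ → ℝ≥0∞)))
    refine ne_of_eq_of_ne h (ne_top_of_le_ne_top (b := ENNReal.ofReal (4 / δ ^ 2) *
      volume (Metric.ball (0 : ℂ) 1)) ?_ ?_)
    · exact ENNReal.mul_ne_top ENNReal.ofReal_ne_top measure_ball_lt_top.ne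
    · rw [← setLIntegral_const]
      refine lintegral_mono fun z => ?_
      by_cases hz : δ ≤ 1 - ‖z‖ ^ 2
      · rw [Set.indicator_of_mem (by exact hz), Pi.one_apply, mul_one, areaDensity]
        gcongr
      · rw [Set.indicator_of_notMem (by exact hz), mul_zero]
        exact zero_le
  have h2 : {p : H2 × ℝ | δ ≤ depth p.1} = {x : H2 | δ ≤ depth x} ×ˢ Set.univ := by
    ext p; simp
  rw [h2, stickMeasure, Measure.prod_prod]
  refine ENNReal.mul_ne_top h1 ?_
  rw [angleMeasure]
  simp [ENNReal.mul_eq_top, Real.pi_pos]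

lemma not_hypUnbounded_of_depth {A : Set H2} {δ : ℝ} (hδ : 0 < δ) (h : ∀ y ∈ A, δ ≤ depth y) :
    ¬ HypUnbounded A := by
  intro hA
  obtain ⟨y, hy, hlt⟩ := hA (Real.arcosh (1 + 2 / δ))
  refine hlt.not_ge ?_
  have hd := h y hy
  have h1 := y.sq_norm_lt_one
  have h2 := depth_pos y
  have h0 : ((0 : H2) : ℂ) = 0 := rfl
  rw [hypDist, h0, zero_sub, norm_neg, norm_zero]
  have h3 : 2 * ‖(y : ℂ)‖ ^ 2 / ((1 - 0 ^ 2) * (1 - ‖(y : ℂ)‖ ^ 2)) ≤ 2 / δ := by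
    rw [show (1 - (0 : ℝ) ^ 2) * (1 - ‖(y : ℂ)‖ ^ 2) = depth y by rw [depth]; ring]
    gcongr
    linarith
  have h4 : 0 ≤ 2 * ‖(y : ℂ)‖ ^ 2 / ((1 - 0 ^ 2) * (1 - ‖(y : ℂ)‖ ^ 2)) := by
    rw [show (1 - (0 : ℝ) ^ 2) * (1 - ‖(y : ℂ)‖ ^ 2) = depth y by rw [depth]; ring]
    positivity
  exact (Real.arcosh_le_arcosh (by linarith) (by positivity)).2 (by linarith)

/-! ### Clusters of sticks and connected components -/

/-- The graph on the indices of the points of a sample, in which different indices are joined if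
their points are related by `r`. -/
def pointGraph {X : Type*} (r : X → X → Prop) (s : Sample X) :
    SimpleGraph {a : ℕ × ℕ // a.2 < s.1 a.1} :=
  SimpleGraph.fromRel fun a b => r (s.2 a.1.1 a.1.2) (s.2 b.1.1 b.1.2)

lemma mem_chainFrom_of_isPath {X : Type*} {r : X → X → Prop} (hr : ∀ p q, r p q → r q p)
    {s : Sample X} {a b : {a : ℕ × ℕ // a.2 < s.1 a.1}} {w : (pointGraph r s).Walk a b}
    (hw : w.IsPath) :
    (s.2 a.1.1 a.1.2, removePoint a.1.1 a.1.2 s) ∈ chainFrom r w.length := by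
  have hsup : w.support.map Subtype.val = a.1 :: w.support.tail.map Subtype.val := by
    rw [← List.map_cons, SimpleGraph.Walk.cons_tail_support]
  refine mem_chainFrom_of_isChain r (l := w.support.tail.map Subtype.val) (by simp) ?_ ?_ ?_
  · rw [← hsup]
    intro c hc
    obtain ⟨d, -, rfl⟩ := List.mem_map.1 hc
    exact d.2
  · rw [← hsup]
    exact hw.support_nodup.map Subtype.val_injective
  · rw [← hsup, List.isChain_map]
    refine w.isChain_adj_support.imp fun c d h => ?_
    rcases h with ⟨-, h | h⟩
    · exact h
    · exact hr _ _ h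

/-- If the sticks are locally finite and if from no region there start arbitrarily long
self-avoiding chains, then the occupied set has only bounded components. -/
lemma not_hasUnboundedComponent {L : ℝ} (hL : 0 ≤ L) {s : Sample (H2 × ℝ)}
    (hfin : ∀ δ > 0, {a : ℕ × ℕ | a.2 < s.1 a.1 ∧ δ ≤ depth (s.2 a.1 a.2).1}.Finite)
    (hchain : ∀ δ > 0, ∃ k, ∀ n i, i < s.1 n → δ ≤ depth (s.2 n i).1 →
      (s.2 n i, removePoint n i s) ∉ chainFrom (Hits L) k) :
    ¬ HasUnboundedComponent (occupied L s) := by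
  rintro ⟨x, hx, hunb⟩
  obtain ⟨κ, hκ0, hκ1, hκ⟩ := exists_depth_ratio hL
  set V := {a : ℕ × ℕ // a.2 < s.1 a.1}
  set G := pointGraph (Hits L) s
  set pt : V → H2 × ℝ := fun a => s.2 a.1.1 a.1.2
  set st : V → Set H2 := fun a => stick L (pt a).1 (pt a).2
  have hocc : occupied L s = ⋃ a, st a := by
    ext y
    simp only [occupied, points, Set.mem_iUnion]
    constructor
    · rintro ⟨_, ⟨n, i, hi, rfl⟩, hy⟩
      exact ⟨⟨(n, i), hi⟩, hy⟩
    · rintro ⟨a, hy⟩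
      exact ⟨pt a, ⟨a.1.1, a.1.2, a.2, rfl⟩, hy⟩
  obtain ⟨a, ha⟩ := Set.mem_iUnion.1 (hocc ▸ hx)
  -- The depths of the centres in the cluster of `a` are bounded below.
  obtain ⟨δ, hδ0, hδ⟩ : ∃ δ > 0, ∀ b, G.Reachable a b → δ ≤ depth (pt b).1 := by
    obtain ⟨k, hk⟩ := hchain _ (depth_pos (pt a).1)
    have hwalk : ∀ (b c : V) (w : G.Walk b c), (κ ^ 2) ^ w.length * depth (pt b).1
        ≤ depth (pt c).1 := by
      intro b c w
      induction w with
      | nil => simp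
      | cons h w ih =>
        rename_i u v _
        have hit : Hits L (pt u) (pt v) := by
          rcases h with ⟨-, h | h⟩
          · exact h
          · exact h.symm
        obtain ⟨y, hy1, hy2⟩ := hit
        have h1 := (hκ _ y hy1).1
        have h2 := (hκ _ y hy2).2
        refine le_trans ?_ ih
        rw [SimpleGraph.Walk.length_cons, pow_succ, mul_assoc]
        gcongr
        calc κ ^ 2 * depth (pt u).1 = κ * (κ * depth (pt u).1) := by ring
          _ ≤ κ * depth y := by gcongr
          _ ≤ _ := h2
    refine ⟨(κ ^ 2) ^ k * depth (pt a).1, by have := depth_pos (pt a).1; positivity,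
      fun b hb => ?_⟩
    obtain ⟨w, hw⟩ := hb.exists_isPath
    have hlen : w.length < k := by
      by_contra! h
      exact hk a.1.1 a.1.2 a.2 le_rfl
        (chainFrom_antitone _ h (mem_chainFrom_of_isPath (fun _ _ => Hits.symm) hw))
    refine le_trans ?_ (hwalk a b w)
    have := depth_pos (pt a).1
    gcongr ?_ * _
    exact pow_le_pow_of_le_one (by positivity) (by nlinarith) hlen.le
  have hlf : LocallyFinite st := by
    intro y
    have hy := depth_pos y
    refine ⟨{z | depth y / 2 < depth z},
      (isOpen_lt continuous_const continuous_depth).mem_nhds (half_lt_self hy), ?_⟩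
    refine Set.Finite.of_finite_image (f := Subtype.val) ?_ Subtype.val_injective.injOn
    refine (hfin (κ * (depth y / 2)) (by positivity)).subset ?_
    rintro _ ⟨b, ⟨z, hz1, hz2⟩, rfl⟩
    refine ⟨b.2, le_trans ?_ (hκ _ z hz1).2⟩
    gcongr
    exact le_of_lt hz2
  have hclosed : ∀ P : V → Prop, IsClosed (⋃ b : {b // P b}, st b) := fun P =>
    (hlf.comp_injective Subtype.val_injective).isClosed_iUnion fun b =>
      (isCompact_stick L _).isClosed
  set K := ⋃ b : {b // G.Reachable a b}, st b
  set N := ⋃ b : {b // ¬ G.Reachable a b}, st b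
  have hdisj : K ∩ N = ∅ := by
    rw [Set.eq_empty_iff_forall_notMem]
    rintro y ⟨hy1, hy2⟩
    obtain ⟨⟨b, hb⟩, hyb⟩ := Set.mem_iUnion.1 hy1
    obtain ⟨⟨c, hc⟩, hyc⟩ := Set.mem_iUnion.1 hy2
    refine hc (hb.trans (SimpleGraph.Adj.reachable ⟨?_, Or.inl ⟨y, hyb, hyc⟩⟩))
    rintro rfl
    exact hc hb
  have hcov : occupied L s ⊆ K ∪ N := by
    rw [hocc]
    refine Set.iUnion_subset fun b y hy => ?_
    by_cases hb : G.Reachable a b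
    · exact Or.inl (Set.mem_iUnion.2 ⟨⟨b, hb⟩, hy⟩)
    · exact Or.inr (Set.mem_iUnion.2 ⟨⟨b, hb⟩, hy⟩)
  have hxK : x ∈ K := Set.mem_iUnion.2 ⟨⟨a, SimpleGraph.Reachable.refl a⟩, ha⟩
  have hsubK : connectedComponentIn (occupied L s) x ⊆ K := by
    have hpre := isPreconnected_connectedComponentIn (x := x) (F := occupied L s)
    rcases isPreconnected_iff_subset_of_disjoint_closed.1 hpre K N (hclosed _) (hclosed _)
      ((connectedComponentIn_subset _ _).trans hcov) (by rw [hdisj, Set.inter_empty]) with h | h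
    · exact h
    · have : x ∈ K ∩ N := ⟨hxK, h (mem_connectedComponentIn hx)⟩
      rw [hdisj] at this
      exact this.elim
  refine not_hypUnbounded_of_depth (mul_pos hκ0 hδ0) (fun y hy => ?_) hunb
  obtain ⟨⟨b, hb⟩, hyb⟩ := Set.mem_iUnion.1 (hsubK hy)
  refine le_trans ?_ (hκ _ y hyb).1
  gcongr
  exact hδ b hb

/-! ### The bound on the critical intensity -/

lemma stickLaw_hasUnboundedComponent_eq_zero {L : ℝ} (hL : 0 < L) {l : ℝ≥0}
    (hl : (l : ℝ≥0∞) < ENNReal.ofReal (Real.pi / 2 * L ^ (-2 : ℤ))) :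
    stickLaw l {s | HasUnboundedComponent (occupied L s)} = 0 := by
  set Λ : Measure (H2 × ℝ) := l • stickMeasure
  set m : ℝ≥0∞ := l * ((ENNReal.ofReal Real.pi)⁻¹ * ENNReal.ofReal (2 * L ^ 2)) with hm
  have hΛ : ∀ A, Λ A = l * stickMeasure A := fun A => by
    rw [Measure.smul_apply, ENNReal.smul_def, smul_eq_mul]
  have hdeg : ∀ q, Λ {p | Hits L q p} ≤ m := fun q => by
    rw [hΛ, hm]
    gcongr
    exact stickMeasure_hits_le hL.le q
  have hm1 : m < 1 := by
    have h1 : (ENNReal.ofReal Real.pi)⁻¹ * ENNReal.ofReal (2 * L ^ 2)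
        = ENNReal.ofReal (Real.pi⁻¹ * (2 * L ^ 2)) := by
      rw [← ENNReal.ofReal_inv_of_pos Real.pi_pos, ← ENNReal.ofReal_mul (by positivity)]
    have h2 : (l : ℝ) < Real.pi / 2 * L ^ (-2 : ℤ) := by
      rw [← ENNReal.ofReal_coe_nnreal] at hl
      exact (ENNReal.ofReal_lt_ofReal_iff (by positivity)).1 hl
    rw [hm, h1, ← ENNReal.ofReal_coe_nnreal, ← ENNReal.ofReal_mul (by positivity),
      ENNReal.ofReal_lt_one]
    calc (l : ℝ) * (Real.pi⁻¹ * (2 * L ^ 2))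
        < Real.pi / 2 * L ^ (-2 : ℤ) * (Real.pi⁻¹ * (2 * L ^ 2)) := by gcongr
      _ = 1 := by
        have := Real.pi_pos.ne'
        rw [zpow_neg]
        field_simp
  have hδm : ∀ j : ℕ, MeasurableSet {p : H2 × ℝ | 1 / ((j : ℝ) + 1) ≤ depth p.1} := fun j =>
    measurableSet_le measurable_const (continuous_depth.measurable.comp measurable_fst)
  have hδf : ∀ j : ℕ, Λ {p : H2 × ℝ | 1 / ((j : ℝ) + 1) ≤ depth p.1} ≠ ∞ := fun j => by
    rw [hΛ]
    exact ENNReal.mul_ne_top ENNReal.coe_ne_top (stickMeasure_depth_ne_top (by positivity))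
  have h1 := ae_all_iff.2 fun j : ℕ => ae_finite_points Λ (hδm j) (hδf j)
  have h2 := ae_all_iff.2 fun j : ℕ =>
    ae_exists_notMem_chainFrom Λ (measurableSet_hits L) hm1 hdeg (hδm j) (hδf j)
  have h3 : ∀ᵐ s ∂(stickLaw l), ¬ HasUnboundedComponent (occupied L s) := by
    filter_upwards [h1, h2] with s hs1 hs2
    refine not_hasUnboundedComponent hL.le (fun δ hδ => ?_) fun δ hδ => ?_
    · obtain ⟨j, hj⟩ := exists_nat_one_div_lt hδ
      exact (hs1 j).subset fun a ha => ⟨ha.1, hj.le.trans ha.2⟩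
    · obtain ⟨j, hj⟩ := exists_nat_one_div_lt hδ
      obtain ⟨k, hk⟩ := hs2 j
      exact ⟨k, fun n i hi hd => hk n i hi (hj.le.trans hd)⟩
  simpa [ae_iff] using h3

end PoissonStick

theorem proposition4p1 (L : ℝ) (hL : 10 ≤ L) :
    ENNReal.ofReal (Real.pi / 2 * L ^ (-2 : ℤ)) ≤ PoissonStick.criticalIntensity L := by
  refine le_sInf ?_
  rintro _ ⟨l, -, hl, rfl⟩
  by_contra! h
  exact hl.ne' (PoissonStick.stickLaw_hasUnboundedComponent_eq_zero (by linarith) h)
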